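/- Let $n\ge 2$, let $A=\mathrm{diag}(a_1,\dots,a_n)$ with all $a_i>0$, write $(\cdot,\cdot)$ for the Euclidean product of $\mathbb R^n$, $u\wedge v=uv^T-vu^T$, $(\xi,\eta)_\kappa=-\frac12\mathrm{tr}(\xi\eta)$ on $\mathfrak{so}(n)$, and let the linear map $\mathbb I$ on $\mathfrak{so}(n)$ satisfy $\mathbb I(u\wedge v)=(Au)\wedge(Av)$ for all $u,v\in\mathbb R^n$. Let $SO(n-1)=\{h\in SO(n): h^{-1}e_n=e_n\}$ act on $SO(n)$ by left multiplication and let $U\in C^\infty(SO(n))$ be $SO(n-1)$-invariant. The multidimensional Veselova system is the nonholonomic system on $Q=SO(n)$ with Lagrangian $L(g,\Omega)=\frac12(\mathbb I\Omega,\Omega)_\kappa-U(g)$, $\Omega=g^{-1}\dot g$, and constraint distribution $D$ given by $\omega_{ij}=0$ for $1\le i,j\le n-1$, where $\omega=\dot g g^{-1}$; its dynamics on $D$ is determined by the Lagrange--d'Alembert principle. It is an $SO(n-1)$-Chaplygin system: $\langle\langle g\Omega_1,g\Omega_2\rangle\rangle=(\mathbb I\Omega_1,\Omega_2)_\kappa$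 is a Riemannian metric, this metric, $U$ and $D$ are $SO(n-1)$-invariant, $T_gQ=D_g\oplus\mathfrak{so}(n-1)\cdot g$, and the quotient map is $\pi:SO(n)\to S^{n-1}$, $\pi(g)=g^{-1}e_n$. Let $\mathrm{hor}$ be the horizontal lift (of vectors or vector fields on $S^{n-1}$ to $D$), $\mathcal P:TQ\to D$ the orthogonal projector of $\langle\langle\cdot,\cdot\rangle\rangle$, and let the gyroscopic tensor $\mathcal T$ on $S^{n-1}$ be given by $$\mathcal T(Y,Z)(\pi(g))=T_g\pi\big(\mathcal P[\mathrm{hor}\,Y,\mathrm{hor}\,Z](g)\big)-[Y,Z](\pi(g)),$$ which is well defined and tensorial. The reduction map $D\to T^*S^{n-1}$ sends $v\in D_g$ to the covector $u\mapsto\langle\langle v,\mathrm{hor}_g u\rangle\rangle$ at $\pi(g)$. The energy and the nonholonomic vector field on $D$ induce through it a smooth reduced Hamiltonian $H$ and a smooth reduced vector field $\overline X_{nh}$ on $T^*S^{n-1}$. Let $\tau:T^*S^{n-1}\to S^{n-1}$ be the projection, $\Omega_{can}$ the canonical symplectic form, $\nu=\Omega_{can}^{n-1}$ the Liouville volume form,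 and $\Omega_{nh}=\Omega_{can}+\Omega_{\mathcal T}$ with $\Omega_{\mathcal T}(\alpha)(V,W)=\alpha(\mathcal T(T\tau V,T\tau W))$. Then: (i) the system is $\phi$-simple with $\phi(\gamma)=-\frac12\ln(A\gamma,\gamma)$, that is, $\mathcal T(Y,Z)=Z[\phi]\,Y-Y[\phi]\,Z$ for all vector fields $Y,Z$ on $S^{n-1}$; (ii) $\overline X_{nh}$ preserves the measure $\mu=(A\gamma,\gamma)^{(2-n)/2}\,\nu$; (iii) after the time reparametrisation $dt=(A\gamma,\gamma)^{1/2}d\tau$ the reduced system is Hamiltonian: the 2-form $\overline\Omega=(A\gamma,\gamma)^{-1/2}\,\Omega_{nh}$ is symplectic and $\mathbf i_{(A\gamma,\gamma)^{1/2}\overline X_{nh}}\overline\Omega=dH$. -/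

import Mathlib

open scoped ContDiff Matrix.Norms.Operator

namespace Veselova

/-! ### Calculus on embedded submanifolds

All manifolds below are closed submanifolds of a finite dimensional normed space `V`, given by
their underlying set. Derivatives along tangent vectors are taken with `fderivWithin`: on vectors
tangent to the submanifold `M`, the value of `fderivWithin ℝ f M x` only depends on `f` on `M`. -/

/-- `f` is a smooth function on the submanifold `M`: it is the restriction to `M` of a smooth
function defined on an open neighbourhood of `M`. -/
def SmoothOn {V W : Type*} [NormedAddCommGroup V] [NormedSpace ℝ V] [NormedAddCommGroup W]
    [NormedSpace ℝ W] (M : Set V) (f : V → W) : Prop :=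
  ∃ (O : Set V) (F : V → W), IsOpen O ∧ M ⊆ O ∧ ContDiffOn ℝ ∞ F O ∧ Set.EqOn f F M

/-! ### The configuration space `SO(n)`, `n = r + 1`, and the shape space `S^{n-1}` -/

/-- The Euclidean space `ℝⁿ`, `n = r + 1`. -/
abbrev Vec (r : ℕ) : Type := EuclideanSpace ℝ (Fin (r + 1))

/-- The real `n × n` matrices, `n = r + 1`. -/
abbrev Mat (r : ℕ) : Type := Matrix (Fin (r + 1)) (Fin (r + 1)) ℝ

variable {r : ℕ}

/-- Product of a matrix and a vector of Euclidean space. -/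
noncomputable def act (g : Mat r) (u : Vec r) : Vec r := WithLp.toLp 2 (g.mulVec u.ofLp)

/-- The last canonical vector `e_n`. -/
noncomputable def eLast (r : ℕ) : Vec r := EuclideanSpace.single (Fin.last r) 1

/-- `u ∧ v = u vᵀ - v uᵀ`. -/
def wedge (u v : Vec r) : Mat r := Matrix.vecMulVec u.ofLp v.ofLp - Matrix.vecMulVec v.ofLp u.ofLp

/-- The metric `(ξ, η)_κ = -½ tr(ξ η)` on `so(n)`. -/
noncomputable def killing (ξ η : Mat r) : ℝ := -(1 / 2) * (ξ * η).trace

/-- The group `SO(n)`, as a submanifold of the space of matrices. -/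
def SO (r : ℕ) : Set (Mat r) := (Matrix.specialOrthogonalGroup (Fin (r + 1)) ℝ : Set (Mat r))

/-- The subgroup `SO(n-1) = {h ∈ SO(n) : h⁻¹ e_n = e_n}`; recall `h⁻¹ = hᵀ` on `SO(n)`. -/
def SOstab (r : ℕ) : Set (Mat r) := {h | h ∈ SO r ∧ act h.transpose (eLast r) = eLast r}

/-- The Lie algebra `so(n)` of skew-symmetric matrices. -/
def so (r : ℕ) : Submodule ℝ (Mat r) where
  carrier := {ξ | ξ.transpose = -ξ}
  add_mem' := by
    intro a b ha hb
    simp only [Set.mem_ofPred_eq] at *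
    rw [Matrix.transpose_add, ha, hb, neg_add]
  zero_mem' := by simp
  smul_mem' := by
    intro c a ha
    simp only [Set.mem_ofPred_eq] at *
    rw [Matrix.transpose_smul, ha, smul_neg]

/-- The Lie algebra of `SO(n-1)`: the `ζ ∈ so(n)` with `ζ e_n = 0`. -/
noncomputable def soStab (r : ℕ) : Submodule ℝ (Mat r) where
  carrier := {ζ | ζ ∈ so r ∧ act ζ (eLast r) = 0}
  add_mem' := by
    rintro a b ⟨ha, ha'⟩ ⟨hb, hb'⟩
    refine ⟨Submodule.add_mem _ ha hb, ?_⟩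
    simp only [act] at *
    rw [Matrix.add_mulVec, WithLp.toLp_add, ha', hb', add_zero]
  zero_mem' := ⟨Submodule.zero_mem _, by simp [act]⟩
  smul_mem' := by
    rintro c a ⟨ha, ha'⟩
    refine ⟨Submodule.smul_mem _ c ha, ?_⟩
    simp only [act] at *
    rw [Matrix.smul_mulVec, WithLp.toLp_smul, ha', smul_zero]

/-- The tangent space `T_g SO(n) = g so(n)`, in the space of matrices. -/
def tangentSO (g : Mat r) : Submodule ℝ (Mat r) := (so r).map (LinearMap.mulLeft ℝ g)

/-- The tangent space `so(n-1) g` at `g` of the orbit of `SO(n-1)`, acting by left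
multiplication. -/
noncomputable def orbitTangent (g : Mat r) : Submodule ℝ (Mat r) := (soStab r).map (LinearMap.mulRight ℝ g)

/-- The constraint distribution: velocities `v = ġ` whose angular velocity in the space frame
`ω = ġ g⁻¹` satisfies `ω_ij = 0` for `1 ≤ i, j ≤ n - 1`. -/
def D (g : Mat r) : Submodule ℝ (Mat r) where
  carrier := {v | v ∈ tangentSO g ∧
    ∀ i j, i ≠ Fin.last r → j ≠ Fin.last r → (v * g.transpose) i j = 0}
  add_mem' := by
    rintro a b ⟨ha, ha'⟩ ⟨hb, hb'⟩
    refine ⟨Submodule.add_mem _ ha hb, fun i j hi hj => ?_⟩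
    rw [add_mul, Matrix.add_apply, ha' i j hi hj, hb' i j hi hj, add_zero]
  zero_mem' := ⟨Submodule.zero_mem _, fun i j _ _ => by simp⟩
  smul_mem' := by
    rintro c a ⟨ha, ha'⟩
    refine ⟨Submodule.smul_mem _ c ha, fun i j hi hj => ?_⟩
    rw [Matrix.smul_mul, Matrix.smul_apply, ha' i j hi hj, smul_zero]

/-- The kinetic energy metric `⟪v, w⟫_g = (𝕀 (g⁻¹ v), g⁻¹ w)_κ` on `SO(n)`. -/
noncomputable def kin (𝕀 : Mat r →ₗ[ℝ] Mat r) (g v w : Mat r) : ℝ :=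
  killing (𝕀 (g.transpose * v)) (g.transpose * w)

/-- The shape space `S^{n-1}`. -/
def Sph (r : ℕ) : Set (Vec r) := Metric.sphere 0 1

/-- The projection `π(g) = g⁻¹ e_n` of `SO(n)` onto `S^{n-1}`. -/
noncomputable def proj (g : Mat r) : Vec r := act g.transpose (eLast r)

/-- The tangent map of `π` (which is the restriction of a linear map). -/
noncomputable def dproj (v : Mat r) : Vec r := act v.transpose (eLast r)

/-- The nonholonomic system on `SO(n)` with kinetic metric `kin 𝕀`, constraint distribution `D`
and potential `U` is an `SO(n-1)`-Chaplygin system with bundle projection `π : SO(n) → S^{n-1}`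
(the action of the compact group `SO(n-1)` is automatically proper). -/
structure IsChaplyginSystem (𝕀 : Mat r →ₗ[ℝ] Mat r) (U : Mat r → ℝ) : Prop where
  metric_symm : ∀ g ∈ SO r, ∀ v ∈ tangentSO g, ∀ w ∈ tangentSO g, kin 𝕀 g v w = kin 𝕀 g w v
  metric_pos : ∀ g ∈ SO r, ∀ v ∈ tangentSO g, v ≠ 0 → 0 < kin 𝕀 g v v
  metric_invariant : ∀ h ∈ SOstab r, ∀ g ∈ SO r, ∀ v ∈ tangentSO g, ∀ w ∈ tangentSO g,
    kin 𝕀 (h * g) (h * v) (h * w) = kin 𝕀 g v w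
  potential_invariant : ∀ h ∈ SOstab r, ∀ g ∈ SO r, U (h * g) = U g
  constraint_invariant : ∀ h ∈ SOstab r, ∀ g ∈ SO r, ∀ v, v ∈ D g ↔ h * v ∈ D (h * g)
  action_free : ∀ h ∈ SOstab r, ∀ g ∈ SO r, h * g = g → h = 1
  splitting_inf : ∀ g ∈ SO r, D g ⊓ orbitTangent g = ⊥
  splitting_sup : ∀ g ∈ SO r, D g ⊔ orbitTangent g = tangentSO g
  proj_image : proj '' SO r = Sph r
  proj_fibre : ∀ g ∈ SO r, ∀ g' ∈ SO r, proj g = proj g' ↔ ∃ h ∈ SOstab r, g' = h * g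

/-! ### The gyroscopic tensor -/

/-- Horizontal lift of `u ∈ T_{π(g)} S^{n-1}`: the vector of `D g` that `π` maps to `u`. -/
noncomputable def hor (g : Mat r) (u : Vec r) : Mat r :=
  Classical.epsilon fun v => v ∈ D g ∧ dproj v = u

/-- Horizontal lift of a vector field on `S^{n-1}`. -/
noncomputable def horField (Y : Vec r → Vec r) (g : Mat r) : Mat r := hor g (Y (proj g))

/-- The orthogonal projector `𝒫 : T_g SO(n) → D g` of the kinetic energy metric. -/
noncomputable def orthProj (𝕀 : Mat r →ₗ[ℝ] Mat r) (g v : Mat r) : Mat r :=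
  Classical.epsilon fun w => w ∈ D g ∧ ∀ z ∈ D g, kin 𝕀 g (v - w) z = 0

/-- Smooth vector fields on `S^{n-1}`. -/
def IsVectorField (Y : Vec r → Vec r) : Prop :=
  SmoothOn (Sph r) Y ∧ ∀ γ ∈ Sph r, inner ℝ γ (Y γ) = 0

/-- The vector `(T_g π)(𝒫 [hor Y, hor Z](g)) - [Y, Z](π(g))`. -/
noncomputable def gyro (𝕀 : Mat r →ₗ[ℝ] Mat r) (Y Z : Vec r → Vec r) (g : Mat r) : Vec r :=
  dproj (orthProj 𝕀 g (VectorField.lieBracketWithin ℝ (horField Y) (horField Z) (SO r) g))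
    - VectorField.lieBracketWithin ℝ Y Z (Sph r) (proj g)

/-- `𝒯` is the gyroscopic tensor, a field of bilinear maps on the tangent spaces of `S^{n-1}`
(values of `𝒯 γ` at vectors that are not tangent at `γ`, or at `γ ∉ S^{n-1}`, are irrelevant). -/
def IsGyroscopicTensor (𝕀 : Mat r →ₗ[ℝ] Mat r) (𝒯 : Vec r → Vec r →ₗ[ℝ] Vec r →ₗ[ℝ] Vec r) :
    Prop :=
  ∀ Y Z, IsVectorField Y → IsVectorField Z → ∀ g ∈ SO r,
    𝒯 (proj g) (Y (proj g)) (Z (proj g)) = gyro 𝕀 Y Z g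

/-- A system with gyroscopic tensor `𝒯` is `φ`-simple: `𝒯(Y, Z) = Z[φ] Y - Y[φ] Z`. -/
def IsPhiSimple (𝒯 : Vec r → Vec r →ₗ[ℝ] Vec r →ₗ[ℝ] Vec r) (φ : Vec r → ℝ) : Prop :=
  SmoothOn (Sph r) φ ∧ ∀ Y Z, IsVectorField Y → IsVectorField Z → ∀ γ ∈ Sph r,
    𝒯 γ (Y γ) (Z γ) = fderivWithin ℝ φ (Sph r) γ (Z γ) • Y γ
      - fderivWithin ℝ φ (Sph r) γ (Y γ) • Z γ

/-! ### The cotangent bundle of `S^{n-1}` -/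

/-- `T^*S^{n-1}`, realised as the set of `(γ, p)` with `|γ| = 1` and `(γ, p) = 0`; the pair `(γ, p)`
is the covector `u ↦ (p, u)` on `T_γ S^{n-1}`. -/
def TS (r : ℕ) : Set (Vec r × Vec r) := {z | z.1 ∈ Sph r ∧ inner ℝ z.1 z.2 = 0}

/-- The tangent vectors to `T^*S^{n-1}` at `z`. -/
def IsTangentTS (z w : Vec r × Vec r) : Prop :=
  inner ℝ z.1 w.1 = 0 ∧ inner ℝ w.1 z.2 + inner ℝ z.1 w.2 = 0

/-- The canonical 2-form `Ω_can = -dλ = ∑ dγ_i ∧ dp_i`, where `λ = ∑ p_i dγ_i` is the Liouville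
1-form. -/
noncomputable def Ωcan (w w' : Vec r × Vec r) : ℝ := inner ℝ w.1 w'.2 - inner ℝ w'.1 w.2

/-- The gyroscopic 2-form: `Ω_𝒯(α)(w, w') = α(𝒯(Tτ w, Tτ w'))`. -/
noncomputable def ΩT (𝒯 : Vec r → Vec r →ₗ[ℝ] Vec r →ₗ[ℝ] Vec r) (z w w' : Vec r × Vec r) : ℝ :=
  inner ℝ z.2 (𝒯 z.1 w.1 w'.1)

/-- The almost symplectic form `Ω_nh = Ω_can + Ω_𝒯`. -/
noncomputable def Ωnh (𝒯 : Vec r → Vec r →ₗ[ℝ] Vec r →ₗ[ℝ] Vec r) (z w w' : Vec r × Vec r) : ℝ :=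
  Ωcan w w' + ΩT 𝒯 z w w'

/-- A 2-form on `T^*S^{n-1}` (given by its values on tangent vectors) is smooth and closed: it is
the restriction of a smooth 2-form of the ambient space whose exterior derivative restricts
to zero. -/
def IsClosedForm (β : Vec r × Vec r → Vec r × Vec r → Vec r × Vec r → ℝ) : Prop :=
  ∃ (O : Set (Vec r × Vec r)) (β' : Vec r × Vec r → (Vec r × Vec r) [⋀^Fin 2]→L[ℝ] ℝ),
    IsOpen O ∧ TS r ⊆ O ∧ ContDiffOn ℝ ∞ β' O ∧
    (∀ z ∈ TS r, ∀ w w', IsTangentTS z w → IsTangentTS z w' → β z w w' = β' z ![w, w']) ∧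
    ∀ z ∈ TS r, ∀ w : Fin 3 → Vec r × Vec r, (∀ i, IsTangentTS z (w i)) → extDeriv β' z w = 0

/-- Symplectic forms on `T^*S^{n-1}`: closed nondegenerate 2-forms. -/
def IsSymplectic (β : Vec r × Vec r → Vec r × Vec r → Vec r × Vec r → ℝ) : Prop :=
  IsClosedForm β ∧ ∀ z ∈ TS r, ∀ w, IsTangentTS z w →
    (∀ w', IsTangentTS z w' → β z w w' = 0) → w = 0

/-! ### The nonholonomic dynamics and its reduction -/

/-- The velocity phase space `D ⊂ T SO(n)` in the left trivialisation: the pairs `(g, Ω)`, with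
`Ω = g⁻¹ ġ` the angular velocity in the body frame. -/
def phaseSpace (r : ℕ) : Set (Mat r × Mat r) := {x | x.1 ∈ SO r ∧ x.1 * x.2 ∈ D x.1}

/-- The Lagrange-d'Alembert equations, for the Lagrangian `L(g, Ω) = ½ (𝕀 Ω, Ω)_κ - U(g)`. At the
state `(g, Ω)` of the constraint manifold, `Ω' = dΩ/dt` is the angular acceleration in the body
frame. The variation of `Ω` in the direction `δg = g η` being `dη/dt + [Ω, η]`, the equations are
`(d/dt (𝕀 Ω), η)_κ = (𝕀 Ω, [Ω, η])_κ - dU(g η)` for all `g η ∈ D g`, and `g Ω' ∈ D g` is the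
time derivative of the constraint (`dω/dt = g Ω' g⁻¹`). -/
def LagrangeDAlembert (𝕀 : Mat r →ₗ[ℝ] Mat r) (U : Mat r → ℝ) (g Ω Ω' : Mat r) : Prop :=
  g * Ω' ∈ D g ∧ ∀ η, g * η ∈ D g →
    killing (𝕀 Ω') η = killing (𝕀 Ω) (Ω * η - η * Ω) - fderivWithin ℝ U (SO r) g (g * η)

/-- The reduction map `D ≅ D^* → D^*/SO(n-1) ≅ T^*S^{n-1}`, the first map being the Legendre
transform: `(g, Ω)` is sent to the covector `u ↦ ⟪g Ω, hor_g u⟫` at `π(g)`. -/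
noncomputable def reduce (𝕀 : Mat r →ₗ[ℝ] Mat r) (x : Mat r × Mat r) : Vec r × Vec r :=
  (proj x.1, Classical.epsilon fun p => inner ℝ (proj x.1) p = 0 ∧
    ∀ u, inner ℝ (proj x.1) u = 0 → inner ℝ p u = kin 𝕀 x.1 (x.1 * x.2) (hor x.1 u))

/-- `H` is the reduced Hamiltonian: it is induced by the energy on `D`. -/
def IsReducedHamiltonian (𝕀 : Mat r →ₗ[ℝ] Mat r) (U : Mat r → ℝ) (H : Vec r × Vec r → ℝ) : Prop :=
  SmoothOn (TS r) H ∧ ∀ x ∈ phaseSpace r, H (reduce 𝕀 x) = 1 / 2 * killing (𝕀 x.2) x.2 + U x.1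

/-- `X` is the reduced vector field on `T^*S^{n-1}`: the vector field of the nonholonomic system
on `D`, whose value at `(g, Ω)` is `(g Ω, Ω')` with `Ω'` given by the Lagrange-d'Alembert equations,
is mapped to `X` by the reduction map. -/
def IsReducedField (𝕀 : Mat r →ₗ[ℝ] Mat r) (U : Mat r → ℝ) (X : Vec r × Vec r → Vec r × Vec r) :
    Prop :=
  SmoothOn (TS r) X ∧ (∀ z ∈ TS r, IsTangentTS z (X z)) ∧
  ∀ x ∈ phaseSpace r, ∃ Ω', LagrangeDAlembert 𝕀 U x.1 x.2 Ω' ∧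
    fderivWithin ℝ (reduce 𝕀) (phaseSpace r) x (x.1 * x.2, Ω') = X (reduce 𝕀 x)

/-! ### Invariant measures and Hamiltonisation -/

/-- The Liouville volume form `ν = Ω_can ∧ ⋯ ∧ Ω_can` (`r` factors). -/
noncomputable def liouville (w : Fin (2 * r) → Vec r × Vec r) : ℝ :=
  (1 / 2) ^ r * ∑ σ : Equiv.Perm (Fin (2 * r)), ((Equiv.Perm.sign σ : ℤ) : ℝ) *
    ∏ k : Fin r, Ωcan (w (σ ⟨2 * k, by omega⟩)) (w (σ ⟨2 * k + 1, by omega⟩))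

/-- The vector field `X` on `T^*S^{n-1}` preserves the basic measure `(f ∘ τ) ν`, that is
`L_X ((f ∘ τ) ν) = 0`. Here `(L_X μ)(w₁, …) = (D_X μ)(w₁, …) + ∑ μ(w₁, …, D_{wᵢ} X, …)`, with
`D` the derivative of the ambient space, in which `ν` is constant. -/
def PreservesBasicMeasure (X : Vec r × Vec r → Vec r × Vec r) (f : Vec r → ℝ) : Prop :=
  SmoothOn (Sph r) f ∧ (∀ γ ∈ Sph r, 0 < f γ) ∧
  ∀ z ∈ TS r, ∀ w : Fin (2 * r) → Vec r × Vec r, (∀ i, IsTangentTS z (w i)) →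
    fderivWithin ℝ (fun y : Vec r × Vec r => f y.1) (TS r) z (X z) * liouville w
      + ∑ i, f z.1 * liouville (Function.update w i (fderivWithin ℝ X (TS r) z (w i))) = 0

/-- The vector field `X` becomes the Hamiltonian vector field of `H` for the symplectic form `β`
after the time reparametrisation `dt = c(γ) dτ`: `c` is a positive smooth function and
`i_{cX} β = dH`. -/
def IsHamiltonisedBy (X : Vec r × Vec r → Vec r × Vec r) (H : Vec r × Vec r → ℝ) (c : Vec r → ℝ)
    (β : Vec r × Vec r → Vec r × Vec r → Vec r × Vec r → ℝ) : Prop :=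
  SmoothOn (Sph r) c ∧ (∀ γ ∈ Sph r, 0 < c γ) ∧ IsSymplectic β ∧
  ∀ z ∈ TS r, ∀ w, IsTangentTS z w → β z (c z.1 • X z) w = fderivWithin ℝ H (TS r) z w

/-- The quadratic form `(A γ, γ)` of `A = diag(a_1, …, a_n)`. -/
noncomputable def quad (a : Fin (r + 1) → ℝ) (γ : Vec r) : ℝ :=
  inner ℝ (act (Matrix.diagonal a) γ) γ

end Veselova

open Filter Topology

namespace Veselova
variable {r : ℕ}

/-! ### Matrices acting on Euclidean vectors -/

/-! Everything is computed on the sphere in closed form. Write `γ = proj g`, `A` for the diagonal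
matrix and `q = quad a γ = (Aγ, γ)`. On skew matrices the inertia operator is `ξ ↦ A ξ A`
(`inertia_apply`), and the constraint space at `g` consists of the `g (γ ∧ u)` with `u ⟂ γ`, this
vector being the horizontal lift of `u` (`mem_D_iff`, `hor_eq`).

Gyroscopic tensor. For tangent fields with values `y`, `z` at `γ`, the bracket of the lifts is `g (y
∧ z + γ ∧ [Y, Z])`. The orthogonal projector replaces `ξ` by `γ ∧ u` with `u = -q⁻¹ ξ A γ`
(`orthProj_mul`). Hence `𝒯(y, z) = q⁻¹ ((Aγ, y) z - (Aγ, z) y)` (`gyro_eq`), and since the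
differential of `φ = -½ ln q` is `-q⁻¹ (Aγ, ·)`, this is φ-simplicity.

Reduced dynamics. The momentum of the velocity `ξ` is `p = q Aξ - (Aγ, ξ) Aγ`, with inverse `ξ = q⁻¹
(A⁻¹p - (A⁻¹p, γ) γ)`. With `V = redPot U` the potential induced by `U`, the Hamiltonian is `½ q⁻¹
(A⁻¹p, p) + V(γ)`, and the Lagrange-d'Alembert equations become `γ' = ξ`, `p' = -∇V - (p, ξ) γ`
(`fderivWithin_reduce`). The reduction map is onto, so every reduced Hamiltonian or field agrees
with these formulas on the cotangent bundle.

Hamiltonisation. With `λ` the Liouville 1-form, differentiating the conformal factor gives `q^{-1/2}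
Ω_nh = -d(q^{-1/2} λ)`: the derivative of `q^{-1/2}` produces exactly the gyroscopic term. The form
is therefore closed, nondegeneracy is seen on vertical vectors first, and `i_X Ω_nh = dH` is a
direct check (`nh_redField`).

Measure. Conceptually, `Ω_𝒯` is semibasic, so the top power of the rescaled form is `q^{-r/2} ν`; it
is invariant under `q^{1/2} X`, so `X` preserves `q^{(1-r)/2} ν`, and `1 - r = 2 - n`. The proof
instead evaluates the Lie derivative on a symplectic frame: the divergence of `X` for `ν` is `(1 -
r) q⁻¹ (A⁻¹p, γ)` (`sum_divergence`), while `X[q] = -2 (A⁻¹p, γ)`. -/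

@[simp] lemma act_ofLp (g : Mat r) (u : Vec r) : (act g u).ofLp = g.mulVec u.ofLp := rfl

lemma inner_eq_dotProduct (u v : Vec r) : inner ℝ u v = u.ofLp ⬝ᵥ v.ofLp := by
  rw [EuclideanSpace.inner_eq_star_dotProduct, dotProduct_comm]; simp

lemma act_mul (g h : Mat r) (u : Vec r) : act (g * h) u = act g (act h u) := by
  simp [act, Matrix.mulVec_mulVec]

@[simp] lemma act_one (u : Vec r) : act 1 u = u := by simp [act]

@[simp] lemma act_zero (g : Mat r) : act g 0 = 0 := by simp [act]

@[simp] lemma zero_act (u : Vec r) : act 0 u = 0 := by simp [act]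

lemma act_add (g : Mat r) (u v : Vec r) : act g (u + v) = act g u + act g v := by
  simp [act, Matrix.mulVec_add]

lemma act_sub (g : Mat r) (u v : Vec r) : act g (u - v) = act g u - act g v := by
  simp [act, Matrix.mulVec_sub]

lemma act_smul (g : Mat r) (c : ℝ) (u : Vec r) : act g (c • u) = c • act g u := by
  simp [act, Matrix.mulVec_smul]

lemma add_act (g h : Mat r) (u : Vec r) : act (g + h) u = act g u + act h u := by
  simp [act, Matrix.add_mulVec]

lemma sub_act (g h : Mat r) (u : Vec r) : act (g - h) u = act g u - act h u := by
  simp [act, Matrix.sub_mulVec]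

lemma neg_act (g : Mat r) (u : Vec r) : act (-g) u = -act g u := by
  simp [act, Matrix.neg_mulVec]

lemma smul_act (c : ℝ) (g : Mat r) (u : Vec r) : act (c • g) u = c • act g u := by
  simp [act, Matrix.smul_mulVec]

lemma inner_act (g : Mat r) (u v : Vec r) : inner ℝ (act g u) v = inner ℝ u (act g.transpose v) := by
  simp only [inner_eq_dotProduct, act_ofLp]
  rw [dotProduct_comm, Matrix.dotProduct_mulVec, dotProduct_comm, Matrix.mulVec_transpose]

lemma ext_act {g h : Mat r} (H : ∀ u, act g u = act h u) : g = h := by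
  apply Matrix.ext_of_mulVec_single
  intro i
  have := congrArg WithLp.ofLp (H (WithLp.toLp 2 (Pi.single i 1)))
  simpa using this

lemma act_wedge (u v x : Vec r) : act (wedge u v) x = inner ℝ v x • u - inner ℝ u x • v := by
  apply WithLp.ofLp_injective
  simp only [act_ofLp, wedge, Matrix.sub_mulVec, Matrix.vecMulVec_mulVec, inner_eq_dotProduct]
  ext i
  simp

lemma transpose_wedge (u v : Vec r) : (wedge u v).transpose = -wedge u v := by
  simp [wedge, Matrix.transpose_vecMulVec]

lemma wedge_mem_so (u v : Vec r) : wedge u v ∈ so r := transpose_wedge u v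

lemma wedge_add (u v w : Vec r) : wedge u (v + w) = wedge u v + wedge u w := by
  refine ext_act fun x => ?_
  simp only [act_wedge, add_act, inner_add_left]; module

lemma wedge_sub (u v w : Vec r) : wedge u (v - w) = wedge u v - wedge u w := by
  refine ext_act fun x => ?_
  simp only [act_wedge, sub_act, inner_sub_left]; module

lemma wedge_smul (c : ℝ) (u v : Vec r) : wedge u (c • v) = c • wedge u v := by
  refine ext_act fun x => ?_
  simp only [act_wedge, smul_act, inner_smul_left]; simp; module

lemma wedge_add_left (u v w : Vec r) : wedge (u + v) w = wedge u w + wedge v w := by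
  refine ext_act fun x => ?_
  simp only [act_wedge, add_act, inner_add_left]; module

lemma wedge_smul_left (c : ℝ) (u v : Vec r) : wedge (c • u) v = c • wedge u v := by
  refine ext_act fun x => ?_
  simp only [act_wedge, smul_act, inner_smul_left]; simp; module

lemma wedge_comm (u v : Vec r) : wedge u v = -wedge v u := by simp [wedge]

lemma mul_wedge_mul_transpose (g : Mat r) (u v : Vec r) :
    g * wedge u v * g.transpose = wedge (act g u) (act g v) := by
  refine ext_act fun x => ?_
  simp only [act_mul, act_wedge, act_sub, act_smul, inner_act]

/-- This is the relation of the symmetric pair behind the sphere: brackets of horizontal elements `γ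
∧ y` lie in the isotropy algebra of `γ`. It enters twice, in the bracket of horizontal lifts and in
the term `[Ω, η]` of the Lagrange-d'Alembert equations. -/
lemma wedge_commutator (γ y z : Vec r) (hγ : inner ℝ γ γ = (1 : ℝ)) (hy : inner ℝ γ y = (0 : ℝ))
    (hz : inner ℝ γ z = (0 : ℝ)) :
    wedge γ y * wedge γ z - wedge γ z * wedge γ y = -wedge y z := by
  refine ext_act fun x => ?_
  have hy' : inner ℝ y γ = (0 : ℝ) := by rw [real_inner_comm]; exact hy
  have hz' : inner ℝ z γ = (0 : ℝ) := by rw [real_inner_comm]; exact hz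
  simp only [sub_act, act_mul, act_wedge, neg_act, inner_sub_right, inner_smul_right, hγ, hy', hz', hy, hz]
  rw [real_inner_comm y z]
  module

/-- The pairing of a skew-symmetric matrix with a simple bivector. -/
lemma killing_wedge {η : Mat r} (hη : η ∈ so r) (u v : Vec r) :
    killing η (wedge u v) = -inner ℝ (act η u) v := by
  have hη : η.transpose = -η := hη
  have h1 : (η * wedge u v).trace = 2 * inner ℝ (act η u) v := by
    have e : inner ℝ (act η v) u = -(inner ℝ (act η u) v : ℝ) := by
      rw [inner_act, hη, neg_act, inner_neg_right, real_inner_comm]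
    rw [wedge, mul_sub, Matrix.mul_vecMulVec, Matrix.mul_vecMulVec, Matrix.trace_sub,
      Matrix.trace_vecMulVec, Matrix.trace_vecMulVec]
    have e1 := inner_eq_dotProduct (act η u) v
    have e2 := inner_eq_dotProduct (act η v) u
    simp only [act_ofLp] at e1 e2
    rw [← e1, ← e2, e]; ring
  rw [killing, h1]; ring

lemma killing_sub_left (ξ ξ' η : Mat r) : killing (ξ - ξ') η = killing ξ η - killing ξ' η := by
  simp [killing, sub_mul]; ring

/-! ### The inertia operator -/

lemma diagonal_act_inner (a : Fin (r + 1) → ℝ) (u v : Vec r) :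
    inner ℝ (act (Matrix.diagonal a) u) v = inner ℝ u (act (Matrix.diagonal a) v) := by
  rw [inner_act, Matrix.diagonal_transpose]

lemma act_diagonal_inv {a : Fin (r + 1) → ℝ} (ha : ∀ i, 0 < a i) (u : Vec r) :
    act (Matrix.diagonal a) (act (Matrix.diagonal a⁻¹) u) = u := by
  rw [← act_mul, Matrix.diagonal_mul_diagonal]
  have : (fun i => a i * a⁻¹ i) = fun _ => 1 := by
    ext i; simp [(ha i).ne']
  rw [this, Matrix.diagonal_one, act_one]

lemma act_inv_diagonal {a : Fin (r + 1) → ℝ} (ha : ∀ i, 0 < a i) (u : Vec r) :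
    act (Matrix.diagonal a⁻¹) (act (Matrix.diagonal a) u) = u := by
  rw [← act_mul, Matrix.diagonal_mul_diagonal]
  have : (fun i => a⁻¹ i * a i) = fun _ => 1 := by
    ext i; simp [(ha i).ne']
  rw [this, Matrix.diagonal_one, act_one]

lemma quad_pos {a : Fin (r + 1) → ℝ} (ha : ∀ i, 0 < a i) {u : Vec r} (hu : u ≠ 0) :
    0 < quad a u := by
  have h : ∃ i, u i ≠ 0 := by
    by_contra! h
    exact hu (by ext i; simpa using h i)
  obtain ⟨i, hi⟩ := h
  rw [quad, inner_eq_dotProduct, act_ofLp, dotProduct]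
  refine Finset.sum_pos' (fun j _ => ?_) ⟨i, Finset.mem_univ _, ?_⟩
  · rw [Matrix.mulVec_diagonal, mul_assoc]
    exact mul_nonneg (ha j).le (mul_self_nonneg _)
  · rw [Matrix.mulVec_diagonal, mul_assoc]
    exact mul_pos (ha i) (mul_self_pos.2 hi)

/-- The sum equals `½ (ξ - ξᵀ)`, which explains the factor `1/2`. It is needed because the inertia
operator is prescribed only on simple bivectors. -/
lemma skew_eq_sum_wedge {ξ : Mat r} (hξ : ξ ∈ so r) :
    ξ = ∑ j, wedge (act ξ (EuclideanSpace.single j ((1 : ℝ) / 2))) (EuclideanSpace.single j 1) := by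
  have hξ : ξ.transpose = -ξ := hξ
  ext i k
  have h := congrFun (congrFun hξ k) i
  simp only [Matrix.transpose_apply, Matrix.neg_apply] at h
  have e : ∀ j : Fin (r + 1), (EuclideanSpace.single j (1 : ℝ)).ofLp = Pi.single j 1 := fun _ => rfl
  have e' : ∀ j : Fin (r + 1), (EuclideanSpace.single j ((1 : ℝ)/2)).ofLp = Pi.single j (1/2) :=
    fun _ => rfl
  simp only [Matrix.sum_apply, wedge, Matrix.sub_apply, Matrix.vecMulVec_apply, act_ofLp, e, e',
    Matrix.mulVec_single, Finset.sum_sub_distrib]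
  simp [Pi.single_apply]
  linarith

/-- Holds because `(Au) ∧ (Av) = A (u ∧ v) Aᵀ` and simple bivectors span the skew matrices. All
later uses of the inertia operator go through this conjugation formula. -/
lemma inertia_apply {a : Fin (r + 1) → ℝ} {𝕀 : Mat r →ₗ[ℝ] Mat r}
    (h𝕀 : ∀ u v : Vec r, 𝕀 (wedge u v) =
      wedge (act (Matrix.diagonal a) u) (act (Matrix.diagonal a) v)) {ξ : Mat r} (hξ : ξ ∈ so r) :
    𝕀 ξ = Matrix.diagonal a * ξ * Matrix.diagonal a := by
  rw [skew_eq_sum_wedge hξ, map_sum, Finset.mul_sum, Finset.sum_mul]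
  refine Finset.sum_congr rfl fun j _ => ?_
  rw [h𝕀, ← mul_wedge_mul_transpose, Matrix.diagonal_transpose]

lemma diagonal_conj_mem_so (a : Fin (r + 1) → ℝ) {ξ : Mat r} (hξ : ξ ∈ so r) :
    Matrix.diagonal a * ξ * Matrix.diagonal a ∈ so r := by
  have hξ : ξ.transpose = -ξ := hξ
  change Matrix.transpose _ = _
  simp [Matrix.transpose_mul, hξ, mul_assoc]

lemma inertia_mem_so {a : Fin (r + 1) → ℝ} {𝕀 : Mat r →ₗ[ℝ] Mat r}
    (h𝕀 : ∀ u v : Vec r, 𝕀 (wedge u v) =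
      wedge (act (Matrix.diagonal a) u) (act (Matrix.diagonal a) v)) {ξ : Mat r} (hξ : ξ ∈ so r) :
    𝕀 ξ ∈ so r := by
  rw [inertia_apply h𝕀 hξ]; exact diagonal_conj_mem_so a hξ

lemma killing_inertia_symm {a : Fin (r + 1) → ℝ} {𝕀 : Mat r →ₗ[ℝ] Mat r}
    (h𝕀 : ∀ u v : Vec r, 𝕀 (wedge u v) =
      wedge (act (Matrix.diagonal a) u) (act (Matrix.diagonal a) v)) {ξ η : Mat r}
    (hξ : ξ ∈ so r) (hη : η ∈ so r) : killing (𝕀 ξ) η = killing (𝕀 η) ξ := by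
  rw [inertia_apply h𝕀 hξ, inertia_apply h𝕀 hη, killing, killing]
  congr 1
  rw [mul_assoc, mul_assoc, Matrix.trace_mul_comm, mul_assoc, Matrix.trace_mul_comm]

lemma killing_inertia_pos {a : Fin (r + 1) → ℝ} (ha : ∀ i, 0 < a i) {𝕀 : Mat r →ₗ[ℝ] Mat r}
    (h𝕀 : ∀ u v : Vec r, 𝕀 (wedge u v) =
      wedge (act (Matrix.diagonal a) u) (act (Matrix.diagonal a) v)) {ξ : Mat r}
    (hξ : ξ ∈ so r) (h0 : ξ ≠ 0) : 0 < killing (𝕀 ξ) ξ := by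
  have hT : ξ.transpose = -ξ := hξ
  have hs : ∀ i j, ξ j i = -ξ i j := fun i j => congrFun (congrFun hT i) j
  -- Skew-symmetry turns the trace into a sum of squares with weights `a i * a j`, from which
  -- positivity can be read off.
  have key : killing (𝕀 ξ) ξ = 1 / 2 * ∑ i, ∑ j, a i * a j * (ξ i j * ξ i j) := by
    rw [inertia_apply h𝕀 hξ, killing, Matrix.trace, neg_mul, ← mul_neg, ← Finset.sum_neg_distrib]
    congr 1
    refine Finset.sum_congr rfl fun i _ => ?_
    rw [Matrix.diag_apply, Matrix.mul_apply, ← Finset.sum_neg_distrib]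
    refine Finset.sum_congr rfl fun j _ => ?_
    rw [Matrix.mul_diagonal, Matrix.diagonal_mul, hs i j]; ring
  have h : ∃ i j, ξ i j ≠ 0 := by
    by_contra! h
    exact h0 (Matrix.ext h)
  obtain ⟨i, j, hij⟩ := h
  rw [key]
  have nn : ∀ i j, 0 ≤ a i * a j * (ξ i j * ξ i j) := fun i j =>
    mul_nonneg (mul_pos (ha i) (ha j)).le (mul_self_nonneg _)
  refine mul_pos (by norm_num) (Finset.sum_pos' (fun i _ => Finset.sum_nonneg fun j _ => nn i j)
    ⟨i, Finset.mem_univ _, Finset.sum_pos' (fun j _ => nn i j) ⟨j, Finset.mem_univ _,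
      mul_pos (mul_pos (ha i) (ha j)) (mul_self_pos.2 hij)⟩⟩)

/-! ### The constraint distribution -/

lemma SO_mul_transpose {g : Mat r} (hg : g ∈ SO r) : g * g.transpose = 1 := by
  have := (Matrix.mem_specialOrthogonalGroup_iff.1 hg).1
  simpa [Matrix.star_eq_conjTranspose] using (Matrix.mem_orthogonalGroup_iff _ _).1 this

lemma SO_transpose_mul {g : Mat r} (hg : g ∈ SO r) : g.transpose * g = 1 :=
  mul_eq_one_comm.1 (SO_mul_transpose hg)

lemma SO_det {g : Mat r} (hg : g ∈ SO r) : g.det = 1 :=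
  (Matrix.mem_specialOrthogonalGroup_iff.1 hg).2

lemma mem_SO_iff {g : Mat r} : g ∈ SO r ↔ g * g.transpose = 1 ∧ g.det = 1 := by
  refine ⟨fun h => ⟨SO_mul_transpose h, SO_det h⟩, fun h => ?_⟩
  refine Matrix.mem_specialOrthogonalGroup_iff.2 ⟨?_, h.2⟩
  rw [Matrix.mem_orthogonalGroup_iff]
  simpa [Matrix.star_eq_conjTranspose] using h.1

lemma SO_mul {g h : Mat r} (hg : g ∈ SO r) (hh : h ∈ SO r) : g * h ∈ SO r := by
  rw [mem_SO_iff]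
  refine ⟨?_, by rw [Matrix.det_mul, SO_det hg, SO_det hh, one_mul]⟩
  rw [Matrix.transpose_mul, mul_assoc, ← mul_assoc h, SO_mul_transpose hh, one_mul,
    SO_mul_transpose hg]

lemma SO_transpose {g : Mat r} (hg : g ∈ SO r) : g.transpose ∈ SO r := by
  rw [mem_SO_iff, Matrix.transpose_transpose, Matrix.det_transpose]
  exact ⟨SO_transpose_mul hg, SO_det hg⟩

lemma inner_eLast : inner ℝ (eLast r) (eLast r) = (1 : ℝ) := by
  simp [eLast]

lemma inner_self_of_mem_Sph {γ : Vec r} (h : γ ∈ Sph r) : inner ℝ γ γ = (1 : ℝ) := by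
  have : ‖γ‖ = 1 := by simpa [Sph] using h
  rw [real_inner_self_eq_norm_sq, this]; norm_num

lemma mem_Sph_iff {γ : Vec r} : γ ∈ Sph r ↔ ‖γ‖ = 1 := by simp [Sph]

lemma mem_Sph_iff_inner {γ : Vec r} : γ ∈ Sph r ↔ inner ℝ γ γ = (1 : ℝ) := by
  refine ⟨inner_self_of_mem_Sph, fun h => ?_⟩
  rw [mem_Sph_iff]
  rw [real_inner_self_eq_norm_sq] at h
  exact (pow_eq_one_iff_of_nonneg (norm_nonneg γ) two_ne_zero).1 h

lemma ne_zero_of_mem_Sph {γ : Vec r} (h : γ ∈ Sph r) : γ ≠ 0 := by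
  rintro rfl
  simpa using inner_self_of_mem_Sph h

lemma proj_mem {g : Mat r} (hg : g ∈ SO r) : proj g ∈ Sph r := by
  rw [mem_Sph_iff_inner, proj, inner_act, ← act_mul, Matrix.transpose_transpose,
    SO_mul_transpose hg, act_one, inner_eLast]

lemma act_proj {g : Mat r} (hg : g ∈ SO r) : act g (proj g) = eLast r := by
  rw [proj, ← act_mul, SO_mul_transpose hg, act_one]

lemma dproj_mul (g η : Mat r) : dproj (g * η) = act η.transpose (proj g) := by
  rw [dproj, Matrix.transpose_mul, act_mul, proj]

lemma inner_act_skew {η : Mat r} (hη : η ∈ so r) (u v : Vec r) :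
    inner ℝ (act η u) v = -(inner ℝ u (act η v) : ℝ) := by
  have hη : η.transpose = -η := hη
  rw [inner_act, hη, neg_act, inner_neg_right]

lemma inner_act_skew_self {η : Mat r} (hη : η ∈ so r) (u : Vec r) :
    inner ℝ u (act η u) = (0 : ℝ) := by
  have := inner_act_skew hη u u
  rw [real_inner_comm] at this
  linarith

lemma mem_tangentSO {g v : Mat r} : v ∈ tangentSO g ↔ ∃ η ∈ so r, v = g * η := by
  simp [tangentSO, eq_comm]

lemma mul_wedge_mem_D {g : Mat r} (hg : g ∈ SO r) (u : Vec r) :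
    g * wedge (proj g) u ∈ D g := by
  refine ⟨mem_tangentSO.2 ⟨_, wedge_mem_so _ _, rfl⟩, fun i j hi hj => ?_⟩
  rw [mul_wedge_mul_transpose, act_proj hg]
  simp [wedge, Matrix.vecMulVec_apply, eLast, hi, hj]

lemma dproj_mul_wedge {g : Mat r} (hg : g ∈ SO r) {u : Vec r} (hu : inner ℝ (proj g) u = (0 : ℝ)) :
    dproj (g * wedge (proj g) u) = u := by
  rw [dproj_mul, transpose_wedge, neg_act, act_wedge, inner_self_of_mem_Sph (proj_mem hg),
    real_inner_comm, hu]
  module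

lemma inner_proj_dproj {g v : Mat r} (hv : v ∈ tangentSO g) : inner ℝ (proj g) (dproj v) = (0 : ℝ) := by
  obtain ⟨η, hη, rfl⟩ := mem_tangentSO.1 hv
  have hT : η.transpose = -η := hη
  rw [dproj_mul, hT, neg_act, inner_neg_right, inner_act_skew_self hη, neg_zero]

/-- In the space frame, the skew matrix `W = g η gᵀ` has zero upper-left block, so its last row
determines it: `W = e_n ∧ Wᵀ e_n`. Conjugating back by `g` turns `e_n` into `γ` and `Wᵀ e_n` into
the projected velocity. -/
lemma eq_mul_wedge_of_mem_D {g v : Mat r} (hg : g ∈ SO r) (hv : v ∈ D g) :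
    v = g * wedge (proj g) (dproj v) := by
  obtain ⟨hvt, hvD⟩ := hv
  obtain ⟨η, hη, rfl⟩ := mem_tangentSO.1 hvt
  have hT : η.transpose = -η := hη
  set W := g * η * g.transpose with hW
  have hWT : W.transpose = -W := by
    rw [hW, Matrix.transpose_mul, Matrix.transpose_mul, hT, Matrix.transpose_transpose]
    simp [mul_assoc]
  have hs : ∀ i j, W j i = -W i j := fun i j => congrFun (congrFun hWT i) j
  have h1 : act g (dproj (g * η)) = act W.transpose (eLast r) := by
    rw [dproj, ← act_mul, hW]
    simp only [Matrix.transpose_mul, Matrix.transpose_transpose, mul_assoc]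
  have h2 : W = wedge (eLast r) (act W.transpose (eLast r)) := by
    have e : (eLast r).ofLp = Pi.single (Fin.last r) 1 := rfl
    ext i j
    simp only [wedge, Matrix.sub_apply, Matrix.vecMulVec_apply, act_ofLp, e, Matrix.mulVec_single]
    by_cases hi : i = Fin.last r <;> by_cases hj : j = Fin.last r
    · subst hi hj
      have := hs (Fin.last r) (Fin.last r)
      simp; linarith
    · subst hi; simp [hj]
    · subst hj; simp [hi, hs i]
    · simp [hi, hj, hvD i j hi hj]
  have h3 : g * η = W * g := by rw [hW, mul_assoc, SO_transpose_mul hg, mul_one]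
  have h4 : g * wedge (proj g) (dproj (g * η)) * g.transpose = W := by
    rw [mul_wedge_mul_transpose, act_proj hg, h1, ← h2]
  conv_lhs => rw [h3, ← h4]
  rw [mul_assoc, SO_transpose_mul hg, mul_one]

lemma mem_D_iff {g v : Mat r} (hg : g ∈ SO r) :
    v ∈ D g ↔ ∃ u, inner ℝ (proj g) u = (0 : ℝ) ∧ v = g * wedge (proj g) u :=
  ⟨fun h => ⟨dproj v, inner_proj_dproj h.1, eq_mul_wedge_of_mem_D hg h⟩,
    fun ⟨u, _, h⟩ => h ▸ mul_wedge_mem_D hg u⟩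

lemma SO_mul_left_cancel {g v w : Mat r} (hg : g ∈ SO r) (h : g * v = g * w) : v = w := by
  have := congrArg (g.transpose * ·) h
  simpa [← mul_assoc, SO_transpose_mul hg] using this

lemma mul_mem_D_iff {g η : Mat r} (hg : g ∈ SO r) :
    g * η ∈ D g ↔ ∃ u, inner ℝ (proj g) u = (0 : ℝ) ∧ η = wedge (proj g) u := by
  rw [mem_D_iff hg]
  constructor
  · rintro ⟨u, hu, h⟩
    exact ⟨u, hu, SO_mul_left_cancel hg h⟩
  · rintro ⟨u, hu, rfl⟩
    exact ⟨u, hu, rfl⟩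

lemma hor_eq {g : Mat r} (hg : g ∈ SO r) {u : Vec r} (hu : inner ℝ (proj g) u = (0 : ℝ)) :
    hor g u = g * wedge (proj g) u := by
  have h : hor g u ∈ D g ∧ dproj (hor g u) = u :=
    Classical.epsilon_spec (p := fun v => v ∈ D g ∧ dproj v = u)
      ⟨_, mul_wedge_mem_D hg u, dproj_mul_wedge hg hu⟩
  rw [eq_mul_wedge_of_mem_D hg h.1, h.2]

/-! ### Differentiability of the elementary operations -/

/-- The action of matrices on vectors, as a continuous bilinear map. -/
noncomputable def actCLM : Mat r →L[ℝ] Vec r →L[ℝ] Vec r :=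
  (LinearMap.mk₂ ℝ act (fun g h u => add_act g h u) (fun c g u => smul_act c g u) act_add
    (fun c g u => act_smul g c u)).toContinuousBilinearMap

/-- The tensor product of vectors, as a continuous bilinear map. -/
noncomputable def outerCLM : Vec r →L[ℝ] Vec r →L[ℝ] Mat r :=
  (LinearMap.mk₂ ℝ (fun u v : Vec r => (Matrix.vecMulVec u.ofLp v.ofLp : Mat r))
    (fun u v w => by simp [Matrix.add_vecMulVec]) (fun c u v => by simp [Matrix.smul_vecMulVec])
    (fun u v w => by simp [Matrix.vecMulVec_add])
    (fun c u v => by simp [Matrix.vecMulVec_smul])).toContinuousBilinearMap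

/-- The wedge product of vectors, as a continuous bilinear map. -/
noncomputable def wedgeCLM : Vec r →L[ℝ] Vec r →L[ℝ] Mat r :=
  (LinearMap.mk₂ ℝ wedge wedge_add_left wedge_smul_left wedge_add
    wedge_smul).toContinuousBilinearMap

/-- `dproj` as a continuous linear map. -/
noncomputable def dprojCLM : Mat r →L[ℝ] Vec r :=
  LinearMap.toContinuousLinearMap
    { toFun := dproj
      map_add' := fun v w => by simp [dproj, add_act]
      map_smul' := fun c v => by simp [dproj, smul_act] }

@[simp] lemma dprojCLM_apply (v : Mat r) : dprojCLM v = dproj v := rfl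

lemma _root_.HasDerivAt.act {g : ℝ → Mat r} {u : ℝ → Vec r} {g' : Mat r} {u' : Vec r} {t : ℝ}
    (hg : HasDerivAt g g' t) (hu : HasDerivAt u u' t) :
    HasDerivAt (fun s => act (g s) (u s)) (act (g t) u' + act g' (u t)) t :=
  actCLM.hasDerivAt_of_bilinear (fun _ => hg) (fun _ => hu)

lemma _root_.HasDerivAt.wedge {u v : ℝ → Vec r} {u' v' : Vec r} {t : ℝ}
    (hu : HasDerivAt u u' t) (hv : HasDerivAt v v' t) :
    HasDerivAt (fun s => wedge (u s) (v s)) (wedge (u t) v' + wedge u' (v t)) t :=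
  wedgeCLM.hasDerivAt_of_bilinear (fun _ => hu) (fun _ => hv)

lemma _root_.HasDerivAt.dproj {g : ℝ → Mat r} {g' : Mat r} {t : ℝ} (hg : HasDerivAt g g' t) :
    HasDerivAt (fun s => dproj (g s)) (dproj g') t :=
  dprojCLM.hasFDerivAt.comp_hasDerivAt t hg

section ContDiff
variable {E : Type*} [NormedAddCommGroup E] [NormedSpace ℝ E] {k : WithTop ℕ∞} {x : E}

lemma _root_.ContDiffAt.act {g : E → Mat r} {u : E → Vec r} (hg : ContDiffAt ℝ k g x)
    (hu : ContDiffAt ℝ k u x) : ContDiffAt ℝ k (fun y => act (g y) (u y)) x :=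
  (actCLM.contDiff.contDiffAt.comp x hg).clm_apply hu

lemma _root_.ContDiffAt.wedge {u v : E → Vec r} (hu : ContDiffAt ℝ k u x)
    (hv : ContDiffAt ℝ k v x) : ContDiffAt ℝ k (fun y => wedge (u y) (v y)) x :=
  (wedgeCLM (r := r)).isBoundedBilinearMap.contDiff.contDiffAt.comp x (hu.prodMk hv)

lemma _root_.ContDiffAt.quad (a : Fin (r + 1) → ℝ) {u : E → Vec r} (hu : ContDiffAt ℝ k u x) :
    ContDiffAt ℝ k (fun y => quad a (u y)) x :=
  (contDiffAt_const.act hu).inner ℝ hu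

lemma contDiffAt_normalize {u : Vec r} (hu : u ≠ 0) :
    ContDiffAt ℝ k (fun y : Vec r => ‖y‖⁻¹ • y) u :=
  ((contDiffAt_norm ℝ hu).inv (norm_ne_zero_iff.2 hu)).smul contDiffAt_id

end ContDiff

/-! ### Reflections and sections of the bundle projection -/

/-- The orthogonal reflection in the hyperplane orthogonal to `w`. -/
noncomputable def refl (w : Vec r) : Mat r :=
  1 - (2 * (inner ℝ w w)⁻¹ : ℝ) • Matrix.vecMulVec w.ofLp w.ofLp

lemma transpose_refl (w : Vec r) : (refl w).transpose = refl w := by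
  simp [refl, Matrix.transpose_vecMulVec]

lemma act_refl (w x : Vec r) :
    act (refl w) x = x - (2 * (inner ℝ w w)⁻¹ * inner ℝ w x : ℝ) • w := by
  apply WithLp.ofLp_injective
  simp only [act_ofLp, refl, Matrix.sub_mulVec, Matrix.smul_mulVec, Matrix.vecMulVec_mulVec,
    inner_eq_dotProduct]
  ext i
  simp
  ring

lemma refl_mul_refl {w : Vec r} (hw : w ≠ 0) : refl w * refl w = 1 := by
  have h : (inner ℝ w w : ℝ) ≠ 0 := inner_self_ne_zero.2 hw
  refine ext_act fun x => ?_
  rw [act_mul, act_refl, act_refl, act_one, inner_sub_right, inner_smul_right]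
  have : (2 * (inner ℝ w w : ℝ)⁻¹ * (inner ℝ w x - 2 * (inner ℝ w w : ℝ)⁻¹ * inner ℝ w x * inner ℝ w w) : ℝ)
      = -(2 * (inner ℝ w w : ℝ)⁻¹ * inner ℝ w x) := by
    field_simp; ring
  rw [this]; module

lemma det_refl {w : Vec r} (hw : w ≠ 0) : (refl w).det = -1 := by
  have h : (inner ℝ w w : ℝ) ≠ 0 := inner_self_ne_zero.2 hw
  have e : refl w = 1 + Matrix.replicateCol Unit (-(2 * (inner ℝ w w : ℝ)⁻¹) • w.ofLp)
      * Matrix.replicateRow Unit w.ofLp := by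
    rw [← Matrix.vecMulVec_eq, Matrix.smul_vecMulVec, refl, neg_smul, sub_eq_add_neg]
  rw [e, Matrix.det_one_add_replicateCol_mul_replicateRow, dotProduct_smul, ← inner_eq_dotProduct,
    smul_eq_mul]
  field_simp
  norm_num

lemma refl_mul_refl_mem_SO {w w' : Vec r} (hw : w ≠ 0) (hw' : w' ≠ 0) :
    refl w * refl w' ∈ SO r := by
  rw [mem_SO_iff, Matrix.transpose_mul, transpose_refl, transpose_refl, Matrix.det_mul,
    det_refl hw, det_refl hw', mul_assoc, ← mul_assoc (refl w'), refl_mul_refl hw', one_mul,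
    refl_mul_refl hw]
  norm_num

lemma contDiffAt_refl {k : WithTop ℕ∞} {w : Vec r} (hw : w ≠ 0) : ContDiffAt ℝ k refl w := by
  have h : (inner ℝ w w : ℝ) ≠ 0 := inner_self_ne_zero.2 hw
  have h1 : ContDiffAt ℝ k (fun y : Vec r => (2 * (inner ℝ y y)⁻¹ : ℝ)) w :=
    contDiffAt_const.mul ((contDiffAt_id.inner ℝ contDiffAt_id).inv h)
  have h2 : ContDiffAt ℝ k (fun y : Vec r => outerCLM y y) w :=
    (outerCLM (r := r)).isBoundedBilinearMap.contDiff.contDiffAt.comp w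
      (contDiffAt_id.prodMk contDiffAt_id)
  exact contDiffAt_const.sub (h1.smul h2)

/-- Rotating the value of the projection from `γ₀` to `γ`. -/
lemma proj_mul_refl {g₀ : Mat r} (hg₀ : g₀ ∈ SO r) {γ : Vec r} (hγ : γ ∈ Sph r)
    (h : γ + proj g₀ ≠ 0) :
    g₀ * (refl (proj g₀) * refl (γ + proj g₀)) ∈ SO r ∧
      proj (g₀ * (refl (proj g₀) * refl (γ + proj g₀))) = γ := by
  have h0 := proj_mem hg₀
  refine ⟨SO_mul hg₀ (refl_mul_refl_mem_SO (ne_zero_of_mem_Sph h0) h), ?_⟩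
  -- The first reflection sends `γ₀ = proj g₀` to `-γ₀`; the second, in the hyperplane orthogonal to
  -- `γ + γ₀`, exchanges `-γ₀` and `γ`. Two reflections make a rotation, and it depends smoothly on
  -- `γ` away from `-γ₀`.
  have e : proj (g₀ * (refl (proj g₀) * refl (γ + proj g₀))) =
      act (refl (γ + proj g₀)) (act (refl (proj g₀)) (proj g₀)) := by
    conv_lhs => rw [proj]
    simp only [Matrix.transpose_mul, transpose_refl, act_mul]
    rfl
  have e1 := inner_self_of_mem_Sph h0
  have e2 := inner_self_of_mem_Sph hγ
  have hne : (inner ℝ (γ + proj g₀) (γ + proj g₀) : ℝ) ≠ 0 := inner_self_ne_zero.2 h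
  have e3 : (inner ℝ (γ + proj g₀) (γ + proj g₀) : ℝ) = 2 * (1 + inner ℝ γ (proj g₀)) := by
    simp only [inner_add_left, inner_add_right, e1, e2, real_inner_comm γ (proj g₀)]; ring
  have e4 : act (refl (proj g₀)) (proj g₀) = -proj g₀ := by
    rw [act_refl, e1]; norm_num; module
  have e5 : (2 * (inner ℝ (γ + proj g₀) (γ + proj g₀))⁻¹ * inner ℝ (γ + proj g₀) (-proj g₀) : ℝ)
      = -1 := by
    rw [e3] at hne ⊢
    rw [inner_neg_right, inner_add_left, e1]
    have hne' : 1 + (inner ℝ γ (proj g₀) : ℝ) ≠ 0 := right_ne_zero_of_mul hne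
    field_simp
    rw [add_comm]
  rw [e, e4, act_refl, e5]
  module

lemma one_mem_SO : (1 : Mat r) ∈ SO r := by simp [mem_SO_iff]

/-- Starting from the identity, the reflection formula reaches every point except `-e_n`. That point
is reached by a second application from a rotation over another basis vector, which exists because
`1 ≤ r`. -/
lemma exists_proj_eq (hr : 1 ≤ r) {γ : Vec r} (hγ : γ ∈ Sph r) : ∃ g ∈ SO r, proj g = γ := by
  have step : ∀ g₀ ∈ SO r, ∀ γ ∈ Sph r, γ + proj g₀ ≠ 0 → ∃ g ∈ SO r, proj g = γ :=
    fun g₀ hg₀ γ hγ h => ⟨_, proj_mul_refl hg₀ hγ h⟩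
  have h1 : proj (1 : Mat r) = eLast r := by simp [proj]
  by_cases h : γ + eLast r = 0
  · have h0 : (EuclideanSpace.single 0 1 : Vec r) ∈ Sph r := by simp [mem_Sph_iff]
    have hl : (0 : Fin (r + 1)) ≠ Fin.last r := by
      rw [Ne, Fin.ext_iff]; simp; omega
    obtain ⟨g₁, hg₁, e₁⟩ := step 1 one_mem_SO _ h0 (by
      rw [h1]; intro hc
      have := congrArg (fun v : Vec r => v 0) hc
      simp [eLast, hl] at this)
    refine step g₁ hg₁ γ hγ ?_
    rw [e₁, eq_neg_of_add_eq_zero_left h]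
    intro hc
    have := congrArg (fun v : Vec r => v 0) hc
    simp [eLast, hl] at this
  · exact step 1 one_mem_SO γ hγ (by rwa [h1])

lemma SOstab_of_proj_eq {g g' : Mat r} (hg : g ∈ SO r) (hg' : g' ∈ SO r) (h : proj g = proj g') :
    g' * g.transpose ∈ SOstab r ∧ g' = g' * g.transpose * g := by
  refine ⟨⟨SO_mul hg' (SO_transpose hg), ?_⟩, ?_⟩
  · rw [Matrix.transpose_mul, Matrix.transpose_transpose, act_mul]
    change act g (proj g') = _
    rw [← h, act_proj hg]
  · rw [mul_assoc, SO_transpose_mul hg, mul_one]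

lemma proj_stab_mul {h : Mat r} (hh : h ∈ SOstab r) (g : Mat r) : proj (h * g) = proj g := by
  rw [proj, Matrix.transpose_mul, act_mul, hh.2, proj]

lemma mem_orbitTangent {g v : Mat r} :
    v ∈ orbitTangent g ↔ ∃ ζ ∈ so r, act ζ (eLast r) = 0 ∧ v = ζ * g := by
  constructor
  · rintro ⟨ζ, ⟨h1, h2⟩, rfl⟩
    exact ⟨ζ, h1, h2, rfl⟩
  · rintro ⟨ζ, h1, h2, rfl⟩
    exact ⟨ζ, ⟨h1, h2⟩, rfl⟩

lemma conj_mem_so {η : Mat r} (hη : η ∈ so r) (g : Mat r) : g * η * g.transpose ∈ so r := by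
  have hη : η.transpose = -η := hη
  change Matrix.transpose _ = _
  simp [Matrix.transpose_mul, hη, mul_assoc]

lemma dproj_of_mem_orbitTangent {g v : Mat r} (hv : v ∈ orbitTangent g) : dproj v = 0 := by
  obtain ⟨ζ, h1, h2, rfl⟩ := mem_orbitTangent.1 hv
  have hT : ζ.transpose = -ζ := h1
  rw [dproj, Matrix.transpose_mul, act_mul, hT, neg_act, h2, neg_zero, act_zero]

lemma mem_orbitTangent_of_dproj {g v : Mat r} (hg : g ∈ SO r) (hv : v ∈ tangentSO g)
    (h : dproj v = 0) : v ∈ orbitTangent g := by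
  obtain ⟨η, hη, rfl⟩ := mem_tangentSO.1 hv
  have hT : η.transpose = -η := hη
  refine mem_orbitTangent.2 ⟨g * η * g.transpose, conj_mem_so hη g, ?_, ?_⟩
  · rw [dproj_mul, hT, neg_act, neg_eq_zero] at h
    rw [act_mul, act_mul]
    change act g (act η (proj g)) = 0
    rw [h, act_zero]
  · rw [mul_assoc, SO_transpose_mul hg, mul_one]

lemma orbitTangent_le {g : Mat r} (hg : g ∈ SO r) : orbitTangent g ≤ tangentSO g := by
  intro v hv
  obtain ⟨ζ, h1, h2, rfl⟩ := mem_orbitTangent.1 hv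
  refine mem_tangentSO.2 ⟨g.transpose * ζ * g, ?_, ?_⟩
  · simpa using conj_mem_so h1 g.transpose
  · rw [← mul_assoc, ← mul_assoc, SO_mul_transpose hg, one_mul]

lemma mul_transpose_mul_cancel {h g v : Mat r} (hh : h ∈ SO r) :
    (h * g).transpose * (h * v) = g.transpose * v := by
  rw [Matrix.transpose_mul, mul_assoc, ← mul_assoc _ h, SO_transpose_mul hh, one_mul]

lemma transpose_mul_mul_cancel {g η : Mat r} (hg : g ∈ SO r) : g.transpose * (g * η) = η := by
  rw [← mul_assoc, SO_transpose_mul hg, one_mul]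

theorem isChaplyginSystem (hr : 1 ≤ r) {a : Fin (r + 1) → ℝ} (ha : ∀ i, 0 < a i)
    {𝕀 : Mat r →ₗ[ℝ] Mat r}
    (h𝕀 : ∀ u v : Vec r, 𝕀 (wedge u v) =
      wedge (act (Matrix.diagonal a) u) (act (Matrix.diagonal a) v))
    {U : Mat r → ℝ} (hUinv : ∀ h ∈ SOstab r, ∀ g ∈ SO r, U (h * g) = U g) :
    IsChaplyginSystem 𝕀 U where
  metric_symm g hg v hv w hw := by
    obtain ⟨η, hη, rfl⟩ := mem_tangentSO.1 hv
    obtain ⟨ζ, hζ, rfl⟩ := mem_tangentSO.1 hw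
    simp only [kin, transpose_mul_mul_cancel hg]
    exact killing_inertia_symm h𝕀 hη hζ
  metric_pos g hg v hv hv0 := by
    obtain ⟨η, hη, rfl⟩ := mem_tangentSO.1 hv
    simp only [kin, transpose_mul_mul_cancel hg]
    refine killing_inertia_pos ha h𝕀 hη ?_
    rintro rfl
    simp at hv0
  metric_invariant h hh g hg v hv w hw := by
    simp only [kin, mul_transpose_mul_cancel hh.1]
  potential_invariant := hUinv
  constraint_invariant h hh g hg v := by
    rw [mem_D_iff hg, mem_D_iff (SO_mul hh.1 hg), proj_stab_mul hh]
    refine exists_congr fun u => and_congr_right fun _ => ?_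
    rw [mul_assoc]
    exact ⟨fun e => by rw [e], fun e => SO_mul_left_cancel hh.1 e⟩
  action_free h hh g hg e := by
    have := congrArg (· * g.transpose) e
    simpa [mul_assoc, SO_mul_transpose hg] using this
  splitting_inf g hg := by
    rw [eq_bot_iff]
    rintro v ⟨h1, h2⟩
    have h3 := eq_mul_wedge_of_mem_D hg h1
    rw [dproj_of_mem_orbitTangent h2] at h3
    rw [h3]
    simp [wedge]
  splitting_sup g hg := by
    refine le_antisymm (sup_le (fun v hv => hv.1) (orbitTangent_le hg)) fun v hv => ?_
    have h1 := mul_wedge_mem_D hg (dproj v)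
    have h2 : v - g * wedge (proj g) (dproj v) ∈ orbitTangent g := by
      refine mem_orbitTangent_of_dproj hg (Submodule.sub_mem _ hv h1.1) ?_
      rw [← dprojCLM_apply, map_sub, dprojCLM_apply, dprojCLM_apply,
        dproj_mul_wedge hg (inner_proj_dproj hv), sub_self]
    exact Submodule.mem_sup.2 ⟨_, h1, _, h2, by abel⟩
  proj_image := by
    ext γ
    constructor
    · rintro ⟨g, hg, rfl⟩
      exact proj_mem hg
    · intro hγ
      obtain ⟨g, hg, e⟩ := exists_proj_eq hr hγ
      exact ⟨g, hg, e⟩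
  proj_fibre g hg g' hg' := by
    constructor
    · intro e
      exact ⟨_, SOstab_of_proj_eq hg hg' e⟩
    · rintro ⟨h, hh, rfl⟩
      rw [proj_stab_mul hh]

/-! ### The reduced potential -/

/-- The function on `ℝⁿ ∖ {0}`, homogeneous of degree zero, that an `SO(n-1)`-invariant function on
`SO(n)` induces on `S^{n-1}`. -/
noncomputable def redPot (U : Mat r → ℝ) (x : Vec r) : ℝ :=
  U (Classical.epsilon fun g => g ∈ SO r ∧ proj g = ‖x‖⁻¹ • x)

lemma normalize_mem {x : Vec r} (hx : x ≠ 0) : ‖x‖⁻¹ • x ∈ Sph r := by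
  rw [mem_Sph_iff, norm_smul, norm_inv, norm_norm, inv_mul_cancel₀ (norm_ne_zero_iff.2 hx)]

lemma redPot_eq {U : Mat r → ℝ} (hUinv : ∀ h ∈ SOstab r, ∀ g ∈ SO r, U (h * g) = U g)
    {g : Mat r} (hg : g ∈ SO r) {x : Vec r} (hx : proj g = ‖x‖⁻¹ • x) : redPot U x = U g := by
  have h := Classical.epsilon_spec (p := fun g => g ∈ SO r ∧ proj g = ‖x‖⁻¹ • x) ⟨g, hg, hx⟩
  obtain ⟨h1, h2⟩ := SOstab_of_proj_eq hg h.1 (hx.trans h.2.symm)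
  rw [redPot, h2, hUinv _ h1 g hg]

lemma redPot_proj {U : Mat r → ℝ} (hUinv : ∀ h ∈ SOstab r, ∀ g ∈ SO r, U (h * g) = U g)
    {g : Mat r} (hg : g ∈ SO r) : redPot U (proj g) = U g :=
  redPot_eq hUinv hg (by rw [mem_Sph_iff.1 (proj_mem hg)]; simp)

lemma redPot_smul (U : Mat r → ℝ) {c : ℝ} (hc : 0 < c) (x : Vec r) :
    redPot U (c • x) = redPot U x := by
  have : ‖c • x‖⁻¹ • c • x = ‖x‖⁻¹ • x := by
    rw [norm_smul, Real.norm_of_nonneg hc.le, smul_smul]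
    congr 1
    field_simp
  rw [redPot, this, redPot]

/-- Near `x` the reflections provide a smooth local section of the bundle projection, composed here
with normalisation. By invariance the induced potential is `U` along that section, whatever element
of the fibre the choice operator selects. -/
lemma contDiffAt_redPot (hr : 1 ≤ r) {U : Mat r → ℝ} (hU : SmoothOn (SO r) U)
    (hUinv : ∀ h ∈ SOstab r, ∀ g ∈ SO r, U (h * g) = U g) {x : Vec r} (hx : x ≠ 0) :
    ContDiffAt ℝ ∞ (redPot U) x := by
  obtain ⟨O, F, hO, hSO, hF, hUF⟩ := hU
  obtain ⟨g₀, hg₀, e₀⟩ := exists_proj_eq hr (normalize_mem hx)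
  set s : Vec r → Mat r := fun y => g₀ * (refl (proj g₀) * refl (‖y‖⁻¹ • y + proj g₀)) with hs
  have hne : ‖x‖⁻¹ • x + proj g₀ ≠ 0 := by
    rw [e₀, ← two_smul ℝ]
    exact smul_ne_zero two_ne_zero (ne_zero_of_mem_Sph (normalize_mem hx))
  have hinner : ContDiffAt ℝ ∞ (fun y : Vec r => ‖y‖⁻¹ • y + proj g₀) x :=
    (contDiffAt_normalize hx).add contDiffAt_const
  have hsd : ContDiffAt ℝ ∞ s x :=
    contDiffAt_const.mul (contDiffAt_const.mul
      (ContDiffAt.comp (g := refl) x (contDiffAt_refl hne) hinner))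
  have hev : ∀ᶠ y in 𝓝 x, redPot U y = F (s y) := by
    filter_upwards [hinner.continuousAt.eventually_ne hne, isOpen_ne.mem_nhds hx] with y h1 h2
    obtain ⟨h3, h4⟩ := proj_mul_refl hg₀ (normalize_mem h2) h1
    rw [redPot_eq hUinv h3 h4, hUF h3]
  have hsx : s x ∈ SO r := (proj_mul_refl hg₀ (normalize_mem hx) hne).1
  exact (ContDiffAt.comp x (hF.contDiffAt (hO.mem_nhds (hSO hsx))) hsd).congr_of_eventuallyEq hev

/-! ### Derivatives along curves in a subset -/

section Curves
variable {E G : Type*} [NormedAddCommGroup E] [NormedSpace ℝ E] [NormedAddCommGroup G]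
  [NormedSpace ℝ G]

/-- `w` is the velocity at `x` of a curve contained in `M`. -/
def HasVelocity (M : Set E) (x w : E) : Prop :=
  ∃ c : ℝ → E, c 0 = x ∧ HasDerivAt c w 0 ∧ ∀ t, c t ∈ M

/-- The derivative within `M` along the velocity of a curve in `M` is computed by any
differentiable extension. -/
lemma HasVelocity.fderivWithin_eq {M : Set E} {x w : E} (h : HasVelocity M x w) {f F : E → G}
    {F' : E →L[ℝ] G} (hF : HasFDerivAt F F' x) (hfF : Set.EqOn f F M) :
    fderivWithin ℝ f M x w = F' w := by
  obtain ⟨c, rfl, hc, hM⟩ := h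
  have h1 : HasFDerivWithinAt f F' M (c 0) := hF.hasFDerivWithinAt.congr hfF (hfF (hM 0))
  have h2 := h1.differentiableWithinAt.hasFDerivWithinAt
  -- Derivatives within a submanifold are not unique as linear maps. Two of them still agree on the
  -- velocity of a curve in `M`, since each computes the derivative of the same function of one real
  -- variable.
  exact (h2.comp_hasDerivAt 0 hc (Eventually.of_forall hM)).unique
    (h1.comp_hasDerivAt 0 hc (Eventually.of_forall hM))

lemma fderivWithin_eq_of_curve {M : Set E} {c : ℝ → E} {w : E} (hc : HasDerivAt c w 0)
    (hM : ∀ t, c t ∈ M) {f F : E → G} (hF : DifferentiableAt ℝ F (c 0)) (hfF : Set.EqOn f F M)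
    {y : G} (hy : HasDerivAt (fun t => F (c t)) y 0) : fderivWithin ℝ f M (c 0) w = y := by
  rw [HasVelocity.fderivWithin_eq ⟨c, rfl, hc, hM⟩ hF.hasFDerivAt hfF]
  exact (hF.hasFDerivAt.comp_hasDerivAt 0 hc).unique hy

end Curves

/-! ### Curves of rotations -/

lemma exp_smul_mul_transpose {η : Mat r} (hη : η ∈ so r) (t : ℝ) :
    NormedSpace.exp (t • η) * (NormedSpace.exp (t • η)).transpose = 1 := by
  have hT : η.transpose = -η := hη
  rw [← Matrix.exp_transpose, Matrix.transpose_smul, hT, smul_neg,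
    ← Matrix.exp_add_of_commute _ _ (Commute.refl (t • η)).neg_right, add_neg_cancel,
    NormedSpace.exp_zero]

lemma transpose_exp_smul {η : Mat r} (hη : η ∈ so r) (t : ℝ) :
    (NormedSpace.exp (t • η)).transpose = NormedSpace.exp (t • (-η)) := by
  have hT : η.transpose = -η := hη
  rw [← Matrix.exp_transpose, Matrix.transpose_smul, hT]

lemma exp_smul_mem_SO {η : Mat r} (hη : η ∈ so r) (t : ℝ) : NormedSpace.exp (t • η) ∈ SO r := by
  rw [mem_SO_iff]
  refine ⟨exp_smul_mul_transpose hη t, ?_⟩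
  -- Orthogonality only gives determinant `±1`. Being a square of an orthogonal matrix fixes the
  -- sign without a continuity argument.
  have h1 : NormedSpace.exp (t • η) = NormedSpace.exp ((t / 2) • η) * NormedSpace.exp ((t / 2) • η) := by
    rw [← Matrix.exp_add_of_commute _ _ rfl, ← add_smul, add_halves]
  have h2 := congrArg Matrix.det (exp_smul_mul_transpose hη (t / 2))
  rw [Matrix.det_mul, Matrix.det_transpose, Matrix.det_one] at h2
  rw [h1, Matrix.det_mul, h2]

lemma hasDerivAt_exp_smul (η : Mat r) : HasDerivAt (fun t : ℝ => NormedSpace.exp (t • η)) η 0 := by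
  have : CompleteSpace (Mat r) := FiniteDimensional.complete ℝ _
  have h := hasDerivAt_exp_smul_const (𝕂 := ℝ) η 0
  rw [zero_smul, NormedSpace.exp_zero, one_mul] at h
  exact h

lemma hasDerivAt_mul_exp_smul (g η : Mat r) :
    HasDerivAt (fun t : ℝ => g * NormedSpace.exp (t • η)) (g * η) 0 :=
  (hasDerivAt_exp_smul η).const_mul g

lemma hasVelocity_SO {g v : Mat r} (hg : g ∈ SO r) (hv : v ∈ tangentSO g) :
    HasVelocity (SO r) g v := by
  obtain ⟨η, hη, rfl⟩ := mem_tangentSO.1 hv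
  exact ⟨fun t => g * NormedSpace.exp (t • η), by simp [NormedSpace.exp_zero],
    hasDerivAt_mul_exp_smul g η, fun t => SO_mul hg (exp_smul_mem_SO hη t)⟩

lemma inner_act_act_of_mem_SO {g : Mat r} (hg : g ∈ SO r) (u v : Vec r) :
    inner ℝ (act g u) (act g v) = (inner ℝ u v : ℝ) := by
  rw [inner_act, ← act_mul, SO_transpose_mul hg, act_one]

lemma hasVelocity_TS {z w : Vec r × Vec r} (hz : z ∈ TS r) (hw : IsTangentTS z w) :
    HasVelocity (TS r) z w := by
  obtain ⟨γ, p⟩ := z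
  obtain ⟨w₁, w₂⟩ := w
  obtain ⟨hγ, hp⟩ := hz
  obtain ⟨h1, h2⟩ := hw
  simp only at hγ hp h1 h2
  have hγ1 := inner_self_of_mem_Sph hγ
  have hR := hasDerivAt_exp_smul (wedge w₁ γ)
  have hS := fun t => exp_smul_mem_SO (wedge_mem_so w₁ γ) t
  have hq : HasDerivAt (fun t : ℝ => p + t • (w₂ + (inner ℝ w₁ p : ℝ) • γ))
      (w₂ + (inner ℝ w₁ p : ℝ) • γ) 0 := by
    simpa using ((hasDerivAt_id (0 : ℝ)).smul_const (w₂ + (inner ℝ w₁ p : ℝ) • γ)).const_add p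
  -- The rotation generated by `w₁ ∧ γ` moves `γ` with velocity `w₁` and `p` with velocity `-(w₁, p)
  -- γ`. The translation by `t (w₂ + (w₁, p) γ)` corrects the latter to `w₂`, and its direction is
  -- orthogonal to `γ` exactly because `w` is tangent.
  refine ⟨fun t => (act (NormedSpace.exp (t • wedge w₁ γ)) γ,
    act (NormedSpace.exp (t • wedge w₁ γ)) (p + t • (w₂ + (inner ℝ w₁ p : ℝ) • γ))), ?_, ?_, ?_⟩
  · simp [NormedSpace.exp_zero]
  · have h1' : (inner ℝ w₁ γ : ℝ) = 0 := by rw [real_inner_comm]; exact h1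
    refine ((hR.act (hasDerivAt_const (0 : ℝ) γ)).prodMk (hR.act hq)).congr_deriv ?_
    simp only [zero_smul, NormedSpace.exp_zero, act_one, add_zero, act_zero, zero_add, act_wedge, hγ1,
      hp, h1']
    refine Prod.ext ?_ ?_ <;> dsimp only <;> module
  · intro t
    refine ⟨?_, ?_⟩
    · rw [mem_Sph_iff_inner]
      simp only
      rw [inner_act_act_of_mem_SO (hS t), hγ1]
    · simp only
      rw [inner_act_act_of_mem_SO (hS t), inner_add_right, inner_smul_right, inner_add_right,
        inner_smul_right, hγ1, hp]
      linear_combination t * h2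

lemma hasVelocity_Sph {γ w : Vec r} (hγ : γ ∈ Sph r) (hw : inner ℝ γ w = (0 : ℝ)) :
    HasVelocity (Sph r) γ w := by
  obtain ⟨c, h1, h2, h3⟩ := hasVelocity_TS (z := (γ, 0)) (w := (w, 0)) ⟨hγ, by simp⟩
    ⟨hw, by simp⟩
  refine ⟨fun t => (c t).1, by simp only [h1], ?_, fun t => (h3 t).1⟩
  exact hasFDerivAt_fst.comp_hasDerivAt 0 h2

/-! ### The gyroscopic tensor -/

lemma _root_.HasDerivAt.quad (a : Fin (r + 1) → ℝ) {u : ℝ → Vec r} {u' : Vec r} {t : ℝ}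
    (hu : HasDerivAt u u' t) :
    HasDerivAt (fun s => quad a (u s)) (2 * inner ℝ (act (Matrix.diagonal a) (u t)) u') t := by
  have h := ((hasDerivAt_const t (Matrix.diagonal a : Mat r)).act hu).inner ℝ hu
  refine h.congr_deriv ?_
  rw [zero_act, add_zero, diagonal_act_inner a u', real_inner_comm]
  ring

/-- The bilinear map `(Y, Z) ↦ ((Aγ, Y) Z - (Aγ, Z) Y) / (Aγ, γ)`. -/
noncomputable def gyroMap (a : Fin (r + 1) → ℝ) (γ : Vec r) : Vec r →ₗ[ℝ] Vec r →ₗ[ℝ] Vec r :=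
  LinearMap.mk₂ ℝ (fun y z => (quad a γ)⁻¹ • ((inner ℝ (act (Matrix.diagonal a) γ) y : ℝ) • z
      - (inner ℝ (act (Matrix.diagonal a) γ) z : ℝ) • y))
    (fun y y' z => by simp only [inner_add_right]; module)
    (fun c y z => by simp only [inner_smul_right]; module)
    (fun y z z' => by simp only [inner_add_right]; module)
    (fun c y z => by simp only [inner_smul_right]; module)

lemma gyroMap_apply (a : Fin (r + 1) → ℝ) (γ y z : Vec r) :
    gyroMap a γ y z = (quad a γ)⁻¹ • ((inner ℝ (act (Matrix.diagonal a) γ) y : ℝ) • z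
      - (inner ℝ (act (Matrix.diagonal a) γ) z : ℝ) • y) := rfl

lemma dproj_mul_wedge_eq {g : Mat r} (hg : g ∈ SO r) (u : Vec r) :
    dproj (g * wedge (proj g) u) = u - (inner ℝ (proj g) u : ℝ) • proj g := by
  rw [dproj_mul, transpose_wedge, neg_act, act_wedge, inner_self_of_mem_Sph (proj_mem hg),
    real_inner_comm]
  module

section Inertia
variable {a : Fin (r + 1) → ℝ} {𝕀 : Mat r →ₗ[ℝ] Mat r}

/-- Against `γ ∧ v` the metric pairs `ξ` to `-(A ξ A γ, v)`, so orthogonality to the constraint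
space follows once `(ξ - γ ∧ u) Aγ = 0`. Since `(ξ Aγ, Aγ) = 0`, the stated `u` solves this
equation. -/
lemma orthProj_mul (ha : ∀ i, 0 < a i)
    (h𝕀 : ∀ u v : Vec r, 𝕀 (wedge u v) =
      wedge (act (Matrix.diagonal a) u) (act (Matrix.diagonal a) v))
    {g ξ : Mat r} (hg : g ∈ SO r) (hξ : ξ ∈ so r) :
    orthProj 𝕀 g (g * ξ) = g * wedge (proj g)
      (-(quad a (proj g))⁻¹ • act ξ (act (Matrix.diagonal a) (proj g))) := by
  have hq : quad a (proj g) ≠ 0 := (quad_pos ha (ne_zero_of_mem_Sph (proj_mem hg))).ne'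
  set u := -(quad a (proj g))⁻¹ • act ξ (act (Matrix.diagonal a) (proj g)) with hu
  have h1 : g * wedge (proj g) u ∈ D g ∧ ∀ z ∈ D g, kin 𝕀 g (g * ξ - g * wedge (proj g) u) z = 0 := by
    refine ⟨mul_wedge_mem_D hg u, fun z hz => ?_⟩
    obtain ⟨v, -, rfl⟩ := (mem_D_iff hg).1 hz
    have hs : ξ - wedge (proj g) u ∈ so r := Submodule.sub_mem _ hξ (wedge_mem_so _ _)
    rw [kin, ← mul_sub, transpose_mul_mul_cancel hg, transpose_mul_mul_cancel hg,
      killing_wedge (inertia_mem_so h𝕀 hs), inertia_apply h𝕀 hs, act_mul, act_mul]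
    have e1 : (inner ℝ (proj g) (act (Matrix.diagonal a) (proj g)) : ℝ) = quad a (proj g) := by
      rw [← diagonal_act_inner, quad]
    have e2 : (inner ℝ u (act (Matrix.diagonal a) (proj g)) : ℝ) = 0 := by
      rw [hu, inner_smul_left, real_inner_comm, inner_act_skew_self hξ, mul_zero]
    have e3 : act (ξ - wedge (proj g) u) (act (Matrix.diagonal a) (proj g)) = 0 := by
      rw [sub_act, act_wedge, e1, e2, hu, smul_smul, mul_neg, mul_inv_cancel₀ hq]
      module
    rw [e3, act_zero, inner_zero_left, neg_zero]
  obtain ⟨h2, h3⟩ := Classical.epsilon_spec (p := fun w => w ∈ D g ∧ ∀ z ∈ D g,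
    kin 𝕀 g (g * ξ - w) z = 0) ⟨_, h1⟩
  change orthProj 𝕀 g (g * ξ) ∈ D g at h2
  set w := orthProj 𝕀 g (g * ξ) with hw
  have h4 : w - g * wedge (proj g) u ∈ D g := Submodule.sub_mem _ h2 h1.1
  -- The difference of two candidates lies in the constraint space and is orthogonal to it, hence to
  -- itself; positive definiteness then gives uniqueness of the chosen projection.
  have h5 : kin 𝕀 g (w - g * wedge (proj g) u) (w - g * wedge (proj g) u) = 0 := by
    have e1 := h3 _ h4
    have e2 := h1.2 _ h4
    change kin 𝕀 g (g * ξ - w) _ = 0 at e1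
    rw [kin, mul_sub g.transpose _ w, map_sub, killing_sub_left] at e1
    rw [kin, mul_sub g.transpose (g * ξ), map_sub, killing_sub_left] at e2
    rw [kin, mul_sub g.transpose w, map_sub, killing_sub_left, ← mul_sub]
    linarith
  obtain ⟨η, hη, e⟩ := mem_tangentSO.1 h4.1
  rw [e, kin, transpose_mul_mul_cancel hg] at h5
  have h6 : η = 0 := by
    by_contra h
    exact (killing_inertia_pos ha h𝕀 hη h).ne' h5
  rw [h6, mul_zero] at e
  exact sub_eq_zero.1 e

/-- On the group the lifted field is `M ↦ M (π(M) ∧ Z(π(M)))` with `π` linear. The Leibniz rule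
along `g exp(t γ ∧ y)` yields one term each from the motion of `g`, of the value of `Z`, and of `γ`.
-/
lemma fderivWithin_horField {g : Mat r} (hg : g ∈ SO r) {y : Vec r}
    (hy : inner ℝ (proj g) y = (0 : ℝ)) {Z F : Vec r → Vec r}
    (hZ : ∀ γ ∈ Sph r, inner ℝ γ (Z γ) = (0 : ℝ)) (hZF : Set.EqOn Z F (Sph r))
    {F' : Vec r →L[ℝ] Vec r} (hF : ContDiffAt ℝ 1 F (proj g)) (hF' : HasFDerivAt F F' (proj g)) :
    fderivWithin ℝ (horField Z) (SO r) g (g * wedge (proj g) y) =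
      g * (wedge (proj g) y * wedge (proj g) (Z (proj g)) + wedge (proj g) (F' y)
        + wedge y (Z (proj g))) := by
  set c : ℝ → Mat r := fun t => g * NormedSpace.exp (t • wedge (proj g) y) with hcdef
  have hc0 : c 0 = g := by simp [c, NormedSpace.exp_zero]
  have hc : HasDerivAt c (g * wedge (proj g) y) 0 := hasDerivAt_mul_exp_smul _ _
  have hcS : ∀ t, c t ∈ SO r := fun t => SO_mul hg (exp_smul_mem_SO (wedge_mem_so _ _) t)
  have hEq : Set.EqOn (horField Z) (fun M => M * wedge (dproj M) (F (dproj M))) (SO r) := by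
    intro M hM
    rw [horField, hor_eq hM (hZ _ (proj_mem hM)), hZF (proj_mem hM)]
    rfl
  have hd : ContDiffAt ℝ 1 (fun M : Mat r => dproj M) g := dprojCLM.contDiff.contDiffAt
  have hdiff : DifferentiableAt ℝ (fun M => M * wedge (dproj M) (F (dproj M))) g :=
    (contDiffAt_id.mul (hd.wedge (ContDiffAt.comp g hF hd))).differentiableAt one_ne_zero
  have hdc : HasDerivAt (fun t => dproj (c t)) y 0 := by
    have := hc.dproj
    rwa [dproj_mul_wedge hg hy] at this
  have hFc : HasDerivAt (fun t => F (dproj (c t))) (F' y) 0 := by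
    refine HasFDerivAt.comp_hasDerivAt (f := fun t => dproj (c t)) 0 ?_ hdc
    rw [hc0]; exact hF'
  have key : fderivWithin ℝ (horField Z) (SO r) (c 0) (g * wedge (proj g) y) = _ :=
    fderivWithin_eq_of_curve hc hcS (by rw [hc0]; exact hdiff) hEq (hc.mul (hdc.wedge hFc))
  rw [hc0] at key
  rw [key]
  change g * wedge (proj g) y * wedge (proj g) (F (proj g)) +
    g * (wedge (proj g) (F' y) + wedge y (F (proj g))) = _
  rw [hZF (proj_mem hg)]
  noncomm_ring

/-- Differentiation of `(γ, Z(γ)) = 0` along a curve in the sphere. The right-hand side is symmetric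
in the values of two fields, which is why their bracket is tangent again. -/
lemma inner_fderiv_of_tangent {γ y : Vec r} (hγ : γ ∈ Sph r) (hy : inner ℝ γ y = (0 : ℝ))
    {Z F : Vec r → Vec r} (hZ : ∀ γ ∈ Sph r, inner ℝ γ (Z γ) = (0 : ℝ))
    (hZF : Set.EqOn Z F (Sph r)) {F' : Vec r →L[ℝ] Vec r} (hF' : HasFDerivAt F F' γ) :
    inner ℝ γ (F' y) = -(inner ℝ y (Z γ) : ℝ) := by
  obtain ⟨c, rfl, hc, hcS⟩ := hasVelocity_Sph hγ hy
  have h1 := hc.inner ℝ (hF'.comp_hasDerivAt 0 hc)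
  have h2 : (fun t => (inner ℝ (c t) ((F ∘ c) t) : ℝ)) = fun _ => 0 := by
    ext t
    rw [Function.comp, ← hZF (hcS t), hZ _ (hcS t)]
  rw [h2] at h1
  have h3 := h1.unique (hasDerivAt_const (0 : ℝ) (0 : ℝ))
  rw [Function.comp, ← hZF (hcS 0)] at h3
  linarith

/-- The bracket of the lifts is `g (y ∧ z + γ ∧ b)`, with `b` the bracket on the sphere. Projecting
the second summand returns `b` and cancels the subtracted bracket; projecting the first leaves `-q⁻¹
(y ∧ z) Aγ` up to a multiple of `γ`, which `dproj` removes. -/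
lemma gyro_eq (ha : ∀ i, 0 < a i)
    (h𝕀 : ∀ u v : Vec r, 𝕀 (wedge u v) =
      wedge (act (Matrix.diagonal a) u) (act (Matrix.diagonal a) v))
    {Y Z : Vec r → Vec r} (hY : IsVectorField Y) (hZ : IsVectorField Z) {g : Mat r} (hg : g ∈ SO r) :
    gyro 𝕀 Y Z g = gyroMap a (proj g) (Y (proj g)) (Z (proj g)) := by
  obtain ⟨⟨O, F, hO, hSO, hF, hYF⟩, hYt⟩ := hY
  obtain ⟨⟨O', G, hO', hSO', hG, hZG⟩, hZt⟩ := hZ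
  have hγ := proj_mem hg
  have hFγ := hF.contDiffAt (hO.mem_nhds (hSO hγ))
  have hGγ := hG.contDiffAt (hO'.mem_nhds (hSO' hγ))
  have hFd := (hFγ.differentiableAt (by simp)).hasFDerivAt
  have hGd := (hGγ.differentiableAt (by simp)).hasFDerivAt
  have hy := hYt _ hγ
  have hz := hZt _ hγ
  have hq : quad a (proj g) ≠ 0 := (quad_pos ha (ne_zero_of_mem_Sph hγ)).ne'
  have e1 := fderivWithin_horField hg hy hZt hZG (hGγ.of_le (by simp)) hGd
  have e2 := fderivWithin_horField hg hz hYt hYF (hFγ.of_le (by simp)) hFd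
  have i1 := inner_fderiv_of_tangent hγ hy hZt hZG hGd
  have i2 := inner_fderiv_of_tangent hγ hz hYt hYF hFd
  have d1 := (hasVelocity_Sph hγ hy).fderivWithin_eq hGd hZG
  have d2 := (hasVelocity_Sph hγ hz).fderivWithin_eq hFd hYF
  rw [gyro, VectorField.lieBracketWithin, VectorField.lieBracketWithin, d1, d2]
  have f1 : horField Y g = g * wedge (proj g) (Y (proj g)) := hor_eq hg hy
  have f2 : horField Z g = g * wedge (proj g) (Z (proj g)) := hor_eq hg hz
  rw [f1, f2]
  change dproj (orthProj 𝕀 g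
    (fderivWithin ℝ (horField Z) (SO r) g (g * wedge (proj g) (Y (proj g)))
      - fderivWithin ℝ (horField Y) (SO r) g (g * wedge (proj g) (Z (proj g))))) - _ = _
  rw [e1, e2]
  generalize hb1 : (fderiv ℝ G (proj g)) (Y (proj g)) = b₁ at *
  generalize hb2 : (fderiv ℝ F (proj g)) (Z (proj g)) = b₂ at *
  generalize Y (proj g) = y at *
  generalize Z (proj g) = z at *
  have hγ1 := inner_self_of_mem_Sph hγ
  have hc := wedge_commutator (proj g) y z hγ1 hy hz
  -- The motion of `γ` contributes `y ∧ z - z ∧ y = 2 y ∧ z`, and the commutator contributes `-y ∧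
  -- z`, so a single `y ∧ z` survives.
  have e3 : g * (wedge (proj g) y * wedge (proj g) z + wedge (proj g) b₁ + wedge y z)
      - g * (wedge (proj g) z * wedge (proj g) y + wedge (proj g) b₂ + wedge z y)
      = g * (wedge y z + wedge (proj g) (b₁ - b₂)) := by
    rw [← mul_sub, wedge_sub, wedge_comm z y]
    congr 1
    rw [sub_eq_iff_eq_add] at hc
    rw [hc]; abel
  have e4 : (inner ℝ (proj g) (b₁ - b₂) : ℝ) = 0 := by
    rw [inner_sub_right, i1, i2, real_inner_comm]; ring
  rw [e3, orthProj_mul ha h𝕀 hg (Submodule.add_mem _ (wedge_mem_so _ _) (wedge_mem_so _ _)),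
    dproj_mul_wedge_eq hg, gyroMap_apply]
  set A := act (Matrix.diagonal a) (proj g) with hA
  have hqA : (inner ℝ (proj g) A : ℝ) = quad a (proj g) := by rw [hA, ← diagonal_act_inner, quad]
  generalize b₁ - b₂ = b at e4 ⊢
  simp only [add_act, act_wedge, hqA, inner_smul_right, inner_add_right, inner_sub_right, hy, hz,
    hγ1, e4, real_inner_comm A]
  match_scalars <;> field_simp <;> ring

theorem isGyroscopicTensor_gyroMap (ha : ∀ i, 0 < a i)
    (h𝕀 : ∀ u v : Vec r, 𝕀 (wedge u v) =
      wedge (act (Matrix.diagonal a) u) (act (Matrix.diagonal a) v)) :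
    IsGyroscopicTensor 𝕀 (gyroMap a) :=
  fun _ _ hY hZ _ hg => (gyro_eq ha h𝕀 hY hZ hg).symm

lemma exists_isVectorField (γ u : Vec r) (hu : inner ℝ γ u = (0 : ℝ)) :
    ∃ Y, IsVectorField Y ∧ Y γ = u := by
  refine ⟨fun x => u - (inner ℝ x u : ℝ) • x, ⟨⟨Set.univ, _, isOpen_univ, Set.subset_univ _, ?_,
    fun _ _ => rfl⟩, ?_⟩, by simp [hu]⟩
  · exact (contDiff_const.sub ((contDiff_id.inner ℝ contDiff_const).smul contDiff_id)).contDiffOn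
  · intro x hx
    rw [inner_sub_right, inner_smul_right, inner_self_of_mem_Sph hx, mul_one, sub_self]

/-- A gyroscopic tensor is specified through vector fields and group elements only. It is determined
on tangent vectors because the projection is onto and each tangent vector is a value of a smooth
tangent field. -/
theorem IsGyroscopicTensor.apply_eq (hr : 1 ≤ r) (ha : ∀ i, 0 < a i)
    (h𝕀 : ∀ u v : Vec r, 𝕀 (wedge u v) =
      wedge (act (Matrix.diagonal a) u) (act (Matrix.diagonal a) v))
    {𝒯 : Vec r → Vec r →ₗ[ℝ] Vec r →ₗ[ℝ] Vec r} (h : IsGyroscopicTensor 𝕀 𝒯) {γ y z : Vec r}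
    (hγ : γ ∈ Sph r) (hy : inner ℝ γ y = (0 : ℝ)) (hz : inner ℝ γ z = (0 : ℝ)) :
    𝒯 γ y z = gyroMap a γ y z := by
  obtain ⟨g, hg, rfl⟩ := exists_proj_eq hr hγ
  obtain ⟨Y, hY, rfl⟩ := exists_isVectorField _ _ hy
  obtain ⟨Z, hZ, rfl⟩ := exists_isVectorField _ _ hz
  rw [h Y Z hY hZ g hg, gyro_eq ha h𝕀 hY hZ hg]

lemma contDiffAt_quad (a : Fin (r + 1) → ℝ) {k : WithTop ℕ∞} (x : Vec r) :
    ContDiffAt ℝ k (quad a) x :=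
  ContDiffAt.quad a contDiffAt_id

lemma Sph_subset_ne_zero : Sph r ⊆ {x : Vec r | x ≠ 0} := fun _ h => ne_zero_of_mem_Sph h

lemma smoothOn_Sph_of_contDiffAt {W : Type*} [NormedAddCommGroup W] [NormedSpace ℝ W]
    {f : Vec r → W} (h : ∀ x ≠ 0, ContDiffAt ℝ ∞ f x) : SmoothOn (Sph r) f :=
  ⟨{x | x ≠ 0}, f, isOpen_ne, Sph_subset_ne_zero, fun x hx => (h x hx).contDiffWithinAt,
    fun _ _ => rfl⟩

theorem isPhiSimple (hr : 1 ≤ r) (ha : ∀ i, 0 < a i)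
    (h𝕀 : ∀ u v : Vec r, 𝕀 (wedge u v) =
      wedge (act (Matrix.diagonal a) u) (act (Matrix.diagonal a) v))
    {𝒯 : Vec r → Vec r →ₗ[ℝ] Vec r →ₗ[ℝ] Vec r} (h : IsGyroscopicTensor 𝕀 𝒯) :
    IsPhiSimple 𝒯 (fun γ => -(1 / 2) * Real.log (quad a γ)) := by
  have hsm : ∀ x : Vec r, x ≠ 0 →
      ContDiffAt ℝ ∞ (fun γ => -(1 / 2) * Real.log (quad a γ)) x := fun x hx =>
    contDiffAt_const.mul ((contDiffAt_quad a x).log (quad_pos ha hx).ne')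
  refine ⟨smoothOn_Sph_of_contDiffAt hsm, fun Y Z hY hZ γ hγ => ?_⟩
  have hq : quad a γ ≠ 0 := (quad_pos ha (ne_zero_of_mem_Sph hγ)).ne'
  have hd : ∀ w, inner ℝ γ w = (0 : ℝ) →
      fderivWithin ℝ (fun γ => -(1 / 2) * Real.log (quad a γ)) (Sph r) γ w =
        -((quad a γ)⁻¹ * inner ℝ (act (Matrix.diagonal a) γ) w) := by
    intro w hw
    obtain ⟨c, rfl, hc, hcS⟩ := hasVelocity_Sph hγ hw
    rw [fderivWithin_eq_of_curve hc hcS ((hsm _ (ne_zero_of_mem_Sph hγ)).differentiableAt (by simp))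
      (fun _ _ => rfl) (((hc.quad a).log hq).const_mul (-(1 / 2)))]
    field_simp
  rw [h.apply_eq hr ha h𝕀 hγ (hY.2 γ hγ) (hZ.2 γ hγ), gyroMap_apply, hd _ (hY.2 γ hγ),
    hd _ (hZ.2 γ hγ)]
  module

end Inertia

/-! ### The Legendre transform on the shape space -/

/-- The velocity on `S^{n-1}` with momentum `p` at `γ`. -/
noncomputable def shapeVel (a : Fin (r + 1) → ℝ) (γ p : Vec r) : Vec r :=
  (quad a γ)⁻¹ • (act (Matrix.diagonal a⁻¹) p - (inner ℝ (act (Matrix.diagonal a⁻¹) p) γ : ℝ) • γ)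

/-- The momentum of the horizontal velocity that projects to `ξ` at `γ`. -/
noncomputable def shapeMom (a : Fin (r + 1) → ℝ) (γ ξ : Vec r) : Vec r :=
  quad a γ • act (Matrix.diagonal a) ξ
    - (inner ℝ (act (Matrix.diagonal a) γ) ξ : ℝ) • act (Matrix.diagonal a) γ

section Legendre
variable {a : Fin (r + 1) → ℝ} {γ : Vec r}

lemma inner_shapeVel (hγ : γ ∈ Sph r) (p : Vec r) : inner ℝ γ (shapeVel a γ p) = (0 : ℝ) := by
  rw [shapeVel, inner_smul_right, inner_sub_right, inner_smul_right, inner_self_of_mem_Sph hγ,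
    real_inner_comm]
  ring

lemma inner_shapeMom (γ ξ : Vec r) : inner ℝ γ (shapeMom a γ ξ) = (0 : ℝ) := by
  rw [shapeMom, inner_sub_right, inner_smul_right, inner_smul_right, ← diagonal_act_inner a γ ξ,
    ← diagonal_act_inner a γ γ, quad]
  ring

/-- The left-hand side is half the rate of change of `q` along the motion. This identity makes both
the invariant density and Hamilton's equations balance. -/
lemma inner_diagonal_shapeVel (ha : ∀ i, 0 < a i) (hγ : γ ∈ Sph r) {p : Vec r}
    (hp : inner ℝ γ p = (0 : ℝ)) : inner ℝ (act (Matrix.diagonal a) γ) (shapeVel a γ p) =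
      -(inner ℝ (act (Matrix.diagonal a⁻¹) p) γ : ℝ) := by
  have hq : quad a γ ≠ 0 := (quad_pos ha (ne_zero_of_mem_Sph hγ)).ne'
  have e : (inner ℝ (act (Matrix.diagonal a) γ) γ : ℝ) = quad a γ := rfl
  rw [shapeVel, inner_smul_right, inner_sub_right, inner_smul_right, e, diagonal_act_inner,
    act_diagonal_inv ha, hp]
  field_simp
  ring

lemma shapeMom_shapeVel (ha : ∀ i, 0 < a i) (hγ : γ ∈ Sph r) {p : Vec r}
    (hp : inner ℝ γ p = (0 : ℝ)) : shapeMom a γ (shapeVel a γ p) = p := by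
  have hq : quad a γ ≠ 0 := (quad_pos ha (ne_zero_of_mem_Sph hγ)).ne'
  rw [shapeMom, inner_diagonal_shapeVel ha hγ hp, shapeVel, act_smul, act_sub, act_smul,
    act_diagonal_inv ha, smul_smul, mul_inv_cancel₀ hq]
  module

lemma shapeVel_shapeMom (ha : ∀ i, 0 < a i) (hγ : γ ∈ Sph r) {ξ : Vec r}
    (hξ : inner ℝ γ ξ = (0 : ℝ)) : shapeVel a γ (shapeMom a γ ξ) = ξ := by
  have hq : quad a γ ≠ 0 := (quad_pos ha (ne_zero_of_mem_Sph hγ)).ne'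
  have hξ' : (inner ℝ ξ γ : ℝ) = 0 := by rw [real_inner_comm]; exact hξ
  rw [shapeVel, shapeMom, act_sub, act_smul, act_smul, act_inv_diagonal ha, act_inv_diagonal ha,
    inner_sub_left, inner_smul_left, inner_smul_left, hξ', inner_self_of_mem_Sph hγ]
  match_scalars
  · field_simp
  · simp

lemma inner_shapeVel_self {p : Vec r} (hp : inner ℝ γ p = (0 : ℝ)) :
    inner ℝ p (shapeVel a γ p) = (quad a γ)⁻¹ * inner ℝ (act (Matrix.diagonal a⁻¹) p) p := by
  rw [shapeVel, inner_smul_right, inner_sub_right, inner_smul_right, real_inner_comm γ p, hp,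
    real_inner_comm p]
  ring

lemma eq_of_inner_eq (γ : Vec r) {x y : Vec r} (h : inner ℝ γ x = (inner ℝ γ y : ℝ))
    (h' : ∀ w, inner ℝ γ w = (0 : ℝ) → inner ℝ x w = (inner ℝ y w : ℝ)) : x = y := by
  have h1 : inner ℝ γ (x - y) = (0 : ℝ) := by rw [inner_sub_right, h, sub_self]
  rw [← sub_eq_zero, ← inner_self_eq_zero (𝕜 := ℝ), inner_sub_left, h' _ h1, sub_self]

end Legendre

/-! ### The reduction map -/

/-- The smooth extension of the reduction map. -/
noncomputable def reduceExt (a : Fin (r + 1) → ℝ) (x : Mat r × Mat r) : Vec r × Vec r :=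
  (dproj x.1, -act (Matrix.diagonal a * x.2 * Matrix.diagonal a) (dproj x.1))

lemma neg_act_conj_wedge (a : Fin (r + 1) → ℝ) (γ ξ : Vec r) :
    -act (Matrix.diagonal a * wedge γ ξ * Matrix.diagonal a) γ = shapeMom a γ ξ := by
  rw [act_mul, act_mul, act_wedge, act_sub, act_smul, act_smul, shapeMom,
    real_inner_comm _ ξ, real_inner_comm _ γ, quad]
  module

lemma mem_phaseSpace_iff {x : Mat r × Mat r} : x ∈ phaseSpace r ↔
    x.1 ∈ SO r ∧ ∃ ξ, inner ℝ (proj x.1) ξ = (0 : ℝ) ∧ x.2 = wedge (proj x.1) ξ :=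
  and_congr_right fun h => mul_mem_D_iff h

section Inertia
variable {a : Fin (r + 1) → ℝ} {𝕀 : Mat r →ₗ[ℝ] Mat r}

/-- The covector chosen in `reduce` is unique, being fixed by its component along `γ` and its
pairings with tangent vectors. It equals `-(A Ω A) γ`, an expression that is smooth on the ambient
space and can therefore be differentiated. -/
lemma reduce_eq
    (h𝕀 : ∀ u v : Vec r, 𝕀 (wedge u v) =
      wedge (act (Matrix.diagonal a) u) (act (Matrix.diagonal a) v)) :
    Set.EqOn (reduce 𝕀) (reduceExt a) (phaseSpace r) := by
  rintro ⟨g, W⟩ hx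
  obtain ⟨hg, ξ, hξ, hW⟩ := mem_phaseSpace_iff.1 hx
  simp only at hg hξ hW
  subst hW
  have hs := wedge_mem_so (proj g) ξ
  have key : inner ℝ (proj g) (shapeMom a (proj g) ξ) = (0 : ℝ) ∧ ∀ u, inner ℝ (proj g) u = (0 : ℝ) →
      inner ℝ (shapeMom a (proj g) ξ) u = kin 𝕀 g (g * wedge (proj g) ξ) (hor g u) := by
    refine ⟨inner_shapeMom _ _, fun u hu => ?_⟩
    rw [hor_eq hg hu, kin, transpose_mul_mul_cancel hg, transpose_mul_mul_cancel hg,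
      killing_wedge (inertia_mem_so h𝕀 hs), inertia_apply h𝕀 hs, ← inner_neg_left,
      neg_act_conj_wedge]
  have h2 := Classical.epsilon_spec (p := fun p => inner ℝ (proj g) p = (0 : ℝ) ∧
    ∀ u, inner ℝ (proj g) u = (0 : ℝ) →
      inner ℝ p u = kin 𝕀 g (g * wedge (proj g) ξ) (hor g u)) ⟨_, key⟩
  refine Prod.ext rfl ?_
  change Classical.epsilon _ = -act _ (proj g)
  rw [neg_act_conj_wedge]
  refine eq_of_inner_eq (proj g) (h2.1.trans key.1.symm) fun w hw => ?_
  rw [h2.2 w hw, key.2 w hw]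

lemma reduce_wedge
    (h𝕀 : ∀ u v : Vec r, 𝕀 (wedge u v) =
      wedge (act (Matrix.diagonal a) u) (act (Matrix.diagonal a) v))
    {g : Mat r} (hg : g ∈ SO r) (ξ : Vec r) :
    reduce 𝕀 (g, wedge (proj g) ξ) = (proj g, shapeMom a (proj g) ξ) := by
  have h : (g, wedge (proj g) ξ) ∈ phaseSpace r := ⟨hg, mul_wedge_mem_D hg ξ⟩
  rw [reduce_eq h𝕀 h, ← neg_act_conj_wedge]
  rfl

lemma exists_reduce_eq (hr : 1 ≤ r) (ha : ∀ i, 0 < a i)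
    (h𝕀 : ∀ u v : Vec r, 𝕀 (wedge u v) =
      wedge (act (Matrix.diagonal a) u) (act (Matrix.diagonal a) v))
    {z : Vec r × Vec r} (hz : z ∈ TS r) : ∃ x ∈ phaseSpace r, reduce 𝕀 x = z := by
  obtain ⟨γ, p⟩ := z
  obtain ⟨hγ, hp⟩ := hz
  obtain ⟨g, hg, rfl⟩ := exists_proj_eq hr hγ
  have h := inner_shapeVel (a := a) hγ p
  refine ⟨(g, wedge (proj g) (shapeVel a (proj g) p)), mem_phaseSpace_iff.2 ⟨hg, _, h, rfl⟩, ?_⟩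
  rw [reduce_wedge h𝕀 hg _, shapeMom_shapeVel ha hγ hp]

/-! ### The reduced Hamiltonian -/

/-- The Hamiltonian `½ (A⁻¹p, p) / (Aγ, γ) + U` on `T^*S^{n-1}`. -/
noncomputable def redHam (a : Fin (r + 1) → ℝ) (U : Mat r → ℝ) (z : Vec r × Vec r) : ℝ :=
  1 / 2 * ((quad a z.1)⁻¹ * inner ℝ (act (Matrix.diagonal a⁻¹) z.2) z.2) + redPot U z.1

lemma redHam_reduce (ha : ∀ i, 0 < a i)
    (h𝕀 : ∀ u v : Vec r, 𝕀 (wedge u v) =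
      wedge (act (Matrix.diagonal a) u) (act (Matrix.diagonal a) v))
    {U : Mat r → ℝ} (hUinv : ∀ h ∈ SOstab r, ∀ g ∈ SO r, U (h * g) = U g)
    {x : Mat r × Mat r} (hx : x ∈ phaseSpace r) :
    redHam a U (reduce 𝕀 x) = 1 / 2 * killing (𝕀 x.2) x.2 + U x.1 := by
  obtain ⟨g, W⟩ := x
  obtain ⟨hg, ξ, hξ, hW⟩ := mem_phaseSpace_iff.1 hx
  simp only at hg hξ hW
  subst hW
  have hs := wedge_mem_so (proj g) ξ
  have hγ := proj_mem hg
  have h0 := inner_shapeMom (a := a) (proj g) ξ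
  rw [reduce_wedge h𝕀 hg _, redHam]
  simp only
  rw [← inner_shapeVel_self h0, shapeVel_shapeMom ha hγ hξ, redPot_proj hUinv hg,
    killing_wedge (inertia_mem_so h𝕀 hs), inertia_apply h𝕀 hs, ← inner_neg_left,
    neg_act_conj_wedge]

lemma TS_subset_ne_zero : TS r ⊆ {z : Vec r × Vec r | z.1 ≠ 0} :=
  fun _ h => ne_zero_of_mem_Sph h.1

lemma isOpen_fst_ne_zero : IsOpen {z : Vec r × Vec r | z.1 ≠ 0} :=
  isOpen_ne.preimage continuous_fst

lemma smoothOn_TS_of_contDiffAt {W : Type*} [NormedAddCommGroup W] [NormedSpace ℝ W]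
    {f : Vec r × Vec r → W} (h : ∀ z, z.1 ≠ 0 → ContDiffAt ℝ ∞ f z) : SmoothOn (TS r) f :=
  ⟨{z | z.1 ≠ 0}, f, isOpen_fst_ne_zero, TS_subset_ne_zero,
    fun z hz => (h z hz).contDiffWithinAt, fun _ _ => rfl⟩

lemma contDiffAt_redHam (hr : 1 ≤ r) (ha : ∀ i, 0 < a i) {U : Mat r → ℝ} (hU : SmoothOn (SO r) U)
    (hUinv : ∀ h ∈ SOstab r, ∀ g ∈ SO r, U (h * g) = U g) {z : Vec r × Vec r} (hz : z.1 ≠ 0) :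
    ContDiffAt ℝ ∞ (redHam a U) z := by
  have h1 : ContDiffAt ℝ ∞ (fun z : Vec r × Vec r => (quad a z.1)⁻¹) z :=
    (ContDiffAt.quad a contDiffAt_fst).inv (quad_pos ha hz).ne'
  have h2 : ContDiffAt ℝ ∞ (fun z : Vec r × Vec r =>
      (inner ℝ (act (Matrix.diagonal a⁻¹) z.2) z.2 : ℝ)) z :=
    (contDiffAt_const.act contDiffAt_snd).inner ℝ contDiffAt_snd
  have h3 : ContDiffAt ℝ ∞ (fun z : Vec r × Vec r => redPot U z.1) z :=
    ContDiffAt.comp (g := redPot U) z (contDiffAt_redPot hr hU hUinv hz) contDiffAt_fst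
  exact (contDiffAt_const.mul (h1.mul h2)).add h3

theorem isReducedHamiltonian_redHam (hr : 1 ≤ r) (ha : ∀ i, 0 < a i)
    (h𝕀 : ∀ u v : Vec r, 𝕀 (wedge u v) =
      wedge (act (Matrix.diagonal a) u) (act (Matrix.diagonal a) v))
    {U : Mat r → ℝ} (hU : SmoothOn (SO r) U)
    (hUinv : ∀ h ∈ SOstab r, ∀ g ∈ SO r, U (h * g) = U g) :
    IsReducedHamiltonian 𝕀 U (redHam a U) :=
  ⟨smoothOn_TS_of_contDiffAt fun _ hz => contDiffAt_redHam hr ha hU hUinv hz,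
    fun _ hx => redHam_reduce ha h𝕀 hUinv hx⟩

lemma IsReducedHamiltonian.eqOn (hr : 1 ≤ r) (ha : ∀ i, 0 < a i)
    (h𝕀 : ∀ u v : Vec r, 𝕀 (wedge u v) =
      wedge (act (Matrix.diagonal a) u) (act (Matrix.diagonal a) v))
    {U : Mat r → ℝ} (hUinv : ∀ h ∈ SOstab r, ∀ g ∈ SO r, U (h * g) = U g)
    {H : Vec r × Vec r → ℝ} (hH : IsReducedHamiltonian 𝕀 U H) :
    Set.EqOn H (redHam a U) (TS r) := by
  intro z hz
  obtain ⟨x, hx, rfl⟩ := exists_reduce_eq hr ha h𝕀 hz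
  rw [hH.2 x hx, redHam_reduce ha h𝕀 hUinv hx]

/-! ### The reduced vector field -/

/-- The vector field `γ' = ξ`, `p' = -∇U - (p, ξ) γ` on `T^*S^{n-1}`, with `ξ` the velocity of
momentum `p`. -/
noncomputable def redField (a : Fin (r + 1) → ℝ) (U : Mat r → ℝ) (z : Vec r × Vec r) :
    Vec r × Vec r :=
  (shapeVel a z.1 z.2,
    -gradient (redPot U) z.1 - (inner ℝ z.2 (shapeVel a z.1 z.2) : ℝ) • z.1)

lemma contDiffAt_shapeVel (ha : ∀ i, 0 < a i) {z : Vec r × Vec r} (hz : z.1 ≠ 0) :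
    ContDiffAt ℝ ∞ (fun z : Vec r × Vec r => shapeVel a z.1 z.2) z := by
  have h1 : ContDiffAt ℝ ∞ (fun z : Vec r × Vec r => (quad a z.1)⁻¹) z :=
    (ContDiffAt.quad a contDiffAt_fst).inv (quad_pos ha hz).ne'
  have h2 : ContDiffAt ℝ ∞ (fun z : Vec r × Vec r => act (Matrix.diagonal a⁻¹) z.2) z :=
    contDiffAt_const.act contDiffAt_snd
  exact h1.smul (h2.sub ((h2.inner ℝ contDiffAt_fst).smul contDiffAt_fst))

lemma contDiffAt_gradient {f : Vec r → ℝ} {x : Vec r} (hf : ContDiffAt ℝ ∞ f x) :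
    ContDiffAt ℝ ∞ (gradient f) x :=
  (InnerProductSpace.toDual ℝ (Vec r)).symm.contDiff.contDiffAt.comp x
    (hf.fderiv_right (m := ∞) (by simp))

lemma contDiffAt_redField (hr : 1 ≤ r) (ha : ∀ i, 0 < a i) {U : Mat r → ℝ}
    (hU : SmoothOn (SO r) U) (hUinv : ∀ h ∈ SOstab r, ∀ g ∈ SO r, U (h * g) = U g)
    {z : Vec r × Vec r} (hz : z.1 ≠ 0) : ContDiffAt ℝ ∞ (redField a U) z := by
  have h1 := contDiffAt_shapeVel ha hz
  have h2 : ContDiffAt ℝ ∞ (fun z : Vec r × Vec r => gradient (redPot U) z.1) z :=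
    ContDiffAt.comp (g := gradient (redPot U)) z
      (contDiffAt_gradient (contDiffAt_redPot hr hU hUinv hz)) contDiffAt_fst
  exact h1.prodMk (h2.neg.sub ((contDiffAt_snd.inner ℝ h1).smul contDiffAt_fst))

lemma inner_gradient_eq (f : Vec r → ℝ) (x w : Vec r) :
    inner ℝ (gradient f x) w = fderiv ℝ f x w := by
  exact inner_gradient_left

/-- Euler's relation for a function homogeneous of degree zero. It makes the ambient gradient
tangent to the sphere, so no projection appears in `redField`. -/
lemma inner_gradient_redPot (hr : 1 ≤ r) {U : Mat r → ℝ} (hU : SmoothOn (SO r) U)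
    (hUinv : ∀ h ∈ SOstab r, ∀ g ∈ SO r, U (h * g) = U g) {γ : Vec r} (hγ : γ ≠ 0) :
    inner ℝ γ (gradient (redPot U) γ) = (0 : ℝ) := by
  rw [real_inner_comm, inner_gradient_eq]
  have h1 := ((contDiffAt_redPot hr hU hUinv hγ).differentiableAt (by simp)).hasFDerivAt
  -- The exponential parametrises the ray so that the scaling factor stays positive for every `t`.
  have h2 : HasDerivAt (fun t : ℝ => Real.exp t • γ) γ 0 := by
    simpa using (Real.hasDerivAt_exp 0).smul_const γ
  have h3 : HasDerivAt (fun t : ℝ => redPot U (Real.exp t • γ)) (fderiv ℝ (redPot U) γ γ) 0 := by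
    have h1' : HasFDerivAt (redPot U) (fderiv ℝ (redPot U) γ) (Real.exp 0 • γ) := by simpa using h1
    exact h1'.comp_hasDerivAt (0 : ℝ) h2
  have h4 : (fun t : ℝ => redPot U (Real.exp t • γ)) = fun _ => redPot U γ := by
    ext t; exact redPot_smul U (Real.exp_pos t) γ
  rw [h4] at h3
  exact h3.unique (hasDerivAt_const _ _)

lemma isTangentTS_redField (hr : 1 ≤ r) {U : Mat r → ℝ} (hU : SmoothOn (SO r) U)
    (hUinv : ∀ h ∈ SOstab r, ∀ g ∈ SO r, U (h * g) = U g) {z : Vec r × Vec r} (hz : z ∈ TS r) :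
    IsTangentTS z (redField a U z) := by
  refine ⟨inner_shapeVel hz.1 _, ?_⟩
  rw [redField]
  simp only
  rw [inner_sub_right, inner_neg_right, inner_smul_right, inner_self_of_mem_Sph hz.1,
    inner_gradient_redPot hr hU hUinv (ne_zero_of_mem_Sph hz.1), real_inner_comm z.2]
  ring

lemma fderivWithin_potential (hr : 1 ≤ r) {U : Mat r → ℝ} (hU : SmoothOn (SO r) U)
    (hUinv : ∀ h ∈ SOstab r, ∀ g ∈ SO r, U (h * g) = U g) {g : Mat r} (hg : g ∈ SO r) {w : Vec r}
    (hw : inner ℝ (proj g) w = (0 : ℝ)) :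
    fderivWithin ℝ U (SO r) g (g * wedge (proj g) w) = inner ℝ (gradient (redPot U) (proj g)) w := by
  have h1 := ((contDiffAt_redPot hr hU hUinv
    (ne_zero_of_mem_Sph (proj_mem hg))).differentiableAt (by simp)).hasFDerivAt
  have h2 : HasFDerivAt (redPot U ∘ dprojCLM) ((fderiv ℝ (redPot U) (proj g)).comp dprojCLM) g :=
    HasFDerivAt.comp g h1 dprojCLM.hasFDerivAt
  have h3 : Set.EqOn U (redPot U ∘ dprojCLM) (SO r) := fun g hg => (redPot_proj hUinv hg).symm
  have h4 : fderivWithin ℝ U (SO r) g (g * wedge (proj g) w) = _ :=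
    (hasVelocity_SO hg (mul_wedge_mem_D hg w).1).fderivWithin_eq h2 h3
  rw [h4, inner_gradient_eq]
  change fderiv ℝ (redPot U) (proj g) (dproj (g * wedge (proj g) w)) = _
  rw [dproj_mul_wedge hg hw]

lemma exists_lagrangeDAlembert (hr : 1 ≤ r) (ha : ∀ i, 0 < a i)
    (h𝕀 : ∀ u v : Vec r, 𝕀 (wedge u v) =
      wedge (act (Matrix.diagonal a) u) (act (Matrix.diagonal a) v))
    {U : Mat r → ℝ} (hU : SmoothOn (SO r) U)
    (hUinv : ∀ h ∈ SOstab r, ∀ g ∈ SO r, U (h * g) = U g) {x : Mat r × Mat r}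
    (hx : x ∈ phaseSpace r) : ∃ W', LagrangeDAlembert 𝕀 U x.1 x.2 W' := by
  obtain ⟨g, W⟩ := x
  obtain ⟨hg, ξ, hξ, hW⟩ := mem_phaseSpace_iff.1 hx
  simp only at hg hξ hW ⊢
  subst hW
  have hγ := proj_mem hg
  have hγ1 := inner_self_of_mem_Sph hγ
  -- By `wedge_commutator`, the right-hand side of the equations on the variation `γ ∧ w` is `(L,
  -- w)`. The left-hand side is the pairing of `w` with the momentum of the acceleration, so the
  -- tangential part of `L` is inverted by the Legendre transform `shapeVel`.
  set L := act (𝕀 (wedge (proj g) ξ)) ξ - gradient (redPot U) (proj g) with hL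
  have hL' : inner ℝ (proj g) (L - (inner ℝ (proj g) L : ℝ) • proj g) = (0 : ℝ) := by
    rw [inner_sub_right, inner_smul_right, hγ1]; ring
  set ξ' := shapeVel a (proj g) (L - (inner ℝ (proj g) L : ℝ) • proj g) with hξ'
  refine ⟨wedge (proj g) ξ', mul_wedge_mem_D hg _, fun η hη => ?_⟩
  obtain ⟨w, hw, rfl⟩ := (mul_mem_D_iff hg).1 hη
  have hs := wedge_mem_so (proj g) ξ
  have hs' := wedge_mem_so (proj g) ξ'
  have hn : -wedge ξ w = wedge ξ (-w) := by
    rw [← neg_one_smul ℝ w, wedge_smul, neg_one_smul]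
  rw [wedge_commutator _ _ _ hγ1 hξ hw, hn, killing_wedge (inertia_mem_so h𝕀 hs),
    killing_wedge (inertia_mem_so h𝕀 hs'), inertia_apply h𝕀 hs', ← inner_neg_left,
    neg_act_conj_wedge, hξ', shapeMom_shapeVel ha hγ hL', fderivWithin_potential hr hU hUinv hg hw,
    inner_sub_left, inner_smul_left, hw, hL, inner_sub_left, inner_neg_right]
  ring

/-- With `M = A Ω A` the momentum is `p = -Mγ`, so `p' = -M'γ - Mξ`. In the Lagrange-d'Alembert
equations the term `(M, [Ω, γ ∧ w])` equals `(Mξ, w)`, and it cancels: the tangential part of `p'`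
is `-∇V` with no gyroscopic term. -/
lemma fderivWithin_reduce (hr : 1 ≤ r) (ha : ∀ i, 0 < a i)
    (h𝕀 : ∀ u v : Vec r, 𝕀 (wedge u v) =
      wedge (act (Matrix.diagonal a) u) (act (Matrix.diagonal a) v))
    {U : Mat r → ℝ} (hU : SmoothOn (SO r) U)
    (hUinv : ∀ h ∈ SOstab r, ∀ g ∈ SO r, U (h * g) = U g) {x : Mat r × Mat r}
    (hx : x ∈ phaseSpace r) {W' : Mat r} (hW' : LagrangeDAlembert 𝕀 U x.1 x.2 W') :
    fderivWithin ℝ (reduce 𝕀) (phaseSpace r) x (x.1 * x.2, W') = redField a U (reduce 𝕀 x) := by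
  obtain ⟨g, W⟩ := x
  obtain ⟨hg, ξ, hξ, hW⟩ := mem_phaseSpace_iff.1 hx
  simp only at hg hξ hW hW' ⊢
  have hγ := proj_mem hg
  have hγ1 := inner_self_of_mem_Sph hγ
  have hs : W ∈ so r := hW ▸ wedge_mem_so (proj g) ξ
  obtain ⟨ξ', hξ', hWξ'⟩ := (mul_mem_D_iff hg).1 hW'.1
  have hs' : W' ∈ so r := hWξ' ▸ wedge_mem_so (proj g) ξ'
  -- a curve in the phase space with the required velocity
  set c : ℝ → Mat r × Mat r := fun t => (g * NormedSpace.exp (t • W),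
    NormedSpace.exp (t • (-W)) * (W + t • W') * NormedSpace.exp (t • W)) with hcdef
  have hc0 : c 0 = (g, W) := by simp [c, NormedSpace.exp_zero]
  have hlin : HasDerivAt (fun t : ℝ => W + t • W') W' 0 := by
    have h := ((hasDerivAt_id (0 : ℝ)).smul_const W').const_add W
    rw [one_smul] at h
    exact h
  have hc1 : HasDerivAt (fun t => (c t).1) (g * W) 0 := hasDerivAt_mul_exp_smul g W
  have hc2 : HasDerivAt (fun t => (c t).2) W' 0 := by
    refine (((hasDerivAt_exp_smul (-W)).mul hlin).mul (hasDerivAt_exp_smul W)).congr_deriv ?_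
    simp [NormedSpace.exp_zero]
  have hc : HasDerivAt c (g * W, W') 0 := hc1.prodMk hc2
  have hcS : ∀ t, c t ∈ phaseSpace r := by
    intro t
    have hE := exp_smul_mem_SO hs t
    have hgE := SO_mul hg hE
    refine ⟨hgE, ?_⟩
    have e1 : proj (g * NormedSpace.exp (t • W)) =
        act (NormedSpace.exp (t • W)).transpose (proj g) := by
      rw [proj, Matrix.transpose_mul, act_mul]; rfl
    have e2 : W + t • W' = wedge (proj g) (ξ + t • ξ') := by
      rw [hW, hWξ', wedge_add, wedge_smul]
    have e3 : (c t).2 = wedge (proj (c t).1)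
        (act (NormedSpace.exp (t • W)).transpose (ξ + t • ξ')) := by
      simp only [hcdef]
      rw [e1, e2, ← mul_wedge_mul_transpose, Matrix.transpose_transpose, transpose_exp_smul hs]
    rw [e3]
    exact mul_wedge_mem_D hgE _
  have hd : DifferentiableAt ℝ (reduceExt a) (c 0) := by
    have h1 : ContDiffAt ℝ 1 (fun x : Mat r × Mat r => dproj x.1) (c 0) :=
      dprojCLM.contDiff.contDiffAt.comp (c 0) contDiffAt_fst
    have h2 : ContDiffAt ℝ 1 (fun x : Mat r × Mat r =>
        Matrix.diagonal a * x.2 * Matrix.diagonal a) (c 0) :=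
      (contDiffAt_const.mul contDiffAt_snd).mul contDiffAt_const
    exact (h1.prodMk (h2.act h1).neg).differentiableAt one_ne_zero
  have hder : HasDerivAt (fun t => reduceExt a (c t)) _ 0 :=
    hc1.dproj.prodMk
      ((((hc2.const_mul (Matrix.diagonal a)).mul_const (Matrix.diagonal a)).act hc1.dproj).neg)
  have key : fderivWithin ℝ (reduce 𝕀) (phaseSpace r) (c 0) (g * W, W') = _ :=
    fderivWithin_eq_of_curve hc hcS hd (reduce_eq h𝕀) hder
  rw [hc0] at key
  have hdW : dproj (g * W) = ξ := by rw [hW, dproj_mul_wedge hg hξ]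
  have hred : reduce 𝕀 (g, W) = (proj g, shapeMom a (proj g) ξ) := by
    rw [hW]; exact reduce_wedge h𝕀 hg _
  rw [key, hred, redField, hdW]
  simp only
  rw [shapeVel_shapeMom ha hγ hξ]
  refine Prod.ext rfl ?_
  change -(act (Matrix.diagonal a * W * Matrix.diagonal a) ξ
    + act (Matrix.diagonal a * W' * Matrix.diagonal a) (proj g)) = _
  have hp : shapeMom a (proj g) ξ = -act (Matrix.diagonal a * W * Matrix.diagonal a) (proj g) := by
    rw [hW, neg_act_conj_wedge]
  have hb := diagonal_conj_mem_so a hs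
  have hb' := diagonal_conj_mem_so a hs'
  simp only
  refine eq_of_inner_eq (proj g) ?_ fun w hw => ?_
  -- Normal component: it is the reaction term `-(p, ξ)`, and only skew-symmetry of `A Ω A` and of
  -- `A Ω' A` is needed.
  · rw [inner_neg_right, inner_add_right, inner_act_skew_self hb', inner_sub_right,
      inner_neg_right, inner_smul_right, hγ1,
      inner_gradient_redPot hr hU hUinv (ne_zero_of_mem_Sph hγ), hp, inner_neg_left,
      inner_act_skew hb]
    ring
  -- Tangential component: the equations of motion tested on the variation `γ ∧ w`.
  · have h1 := hW'.2 _ (mul_wedge_mem_D hg w)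
    have hn : -wedge ξ w = wedge ξ (-w) := by
      rw [← neg_one_smul ℝ w, wedge_smul, neg_one_smul]
    rw [killing_wedge (inertia_mem_so h𝕀 hs'), inertia_apply h𝕀 hs',
      fderivWithin_potential hr hU hUinv hg hw] at h1
    nth_rewrite 2 3 [hW] at h1
    rw [wedge_commutator _ _ _ hγ1 hξ hw, hn, killing_wedge (inertia_mem_so h𝕀 hs),
      inertia_apply h𝕀 hs, inner_neg_right] at h1
    rw [inner_neg_left, inner_add_left, inner_sub_left, inner_neg_left, inner_smul_left, hw]
    linarith

theorem isReducedField_redField (hr : 1 ≤ r) (ha : ∀ i, 0 < a i)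
    (h𝕀 : ∀ u v : Vec r, 𝕀 (wedge u v) =
      wedge (act (Matrix.diagonal a) u) (act (Matrix.diagonal a) v))
    {U : Mat r → ℝ} (hU : SmoothOn (SO r) U)
    (hUinv : ∀ h ∈ SOstab r, ∀ g ∈ SO r, U (h * g) = U g) :
    IsReducedField 𝕀 U (redField a U) := by
  refine ⟨smoothOn_TS_of_contDiffAt fun _ hz => contDiffAt_redField hr ha hU hUinv hz,
    fun z hz => isTangentTS_redField hr hU hUinv hz, fun x hx => ?_⟩
  obtain ⟨W', hW'⟩ := exists_lagrangeDAlembert hr ha h𝕀 hU hUinv hx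
  exact ⟨W', hW', fderivWithin_reduce hr ha h𝕀 hU hUinv hx hW'⟩

/-- Every point of the cotangent bundle is a reduced state, and `fderivWithin_reduce` holds for any
solution `W'` of the Lagrange-d'Alembert equations, so the particular acceleration supplied by the
hypothesis is irrelevant. -/
lemma IsReducedField.eqOn (hr : 1 ≤ r) (ha : ∀ i, 0 < a i)
    (h𝕀 : ∀ u v : Vec r, 𝕀 (wedge u v) =
      wedge (act (Matrix.diagonal a) u) (act (Matrix.diagonal a) v))
    {U : Mat r → ℝ} (hU : SmoothOn (SO r) U)
    (hUinv : ∀ h ∈ SOstab r, ∀ g ∈ SO r, U (h * g) = U g)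
    {X : Vec r × Vec r → Vec r × Vec r} (hX : IsReducedField 𝕀 U X) :
    Set.EqOn X (redField a U) (TS r) := by
  intro z hz
  obtain ⟨x, hx, rfl⟩ := exists_reduce_eq hr ha h𝕀 hz
  obtain ⟨W', hW', e⟩ := hX.2.2 x hx
  rw [← e, fderivWithin_reduce hr ha h𝕀 hU hUinv hx hW']

end Inertia

/-! ### Hamiltonisation -/

lemma contDiffAt_quad_rpow {a : Fin (r + 1) → ℝ} (ha : ∀ i, 0 < a i) (s : ℝ) {x : Vec r}
    (hx : x ≠ 0) : ContDiffAt ℝ ∞ (fun x => quad a x ^ s) x :=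
  (contDiffAt_quad a x).rpow_const_of_ne (quad_pos ha hx).ne'

lemma _root_.HasDerivAt.quad_rpow {a : Fin (r + 1) → ℝ} (ha : ∀ i, 0 < a i) (s : ℝ)
    {u : ℝ → Vec r} {u' : Vec r} {t : ℝ} (hu : HasDerivAt u u' t) (h0 : u t ≠ 0) :
    HasDerivAt (fun x => quad a (u x) ^ s)
      (2 * s * (inner ℝ (act (Matrix.diagonal a) (u t)) u' * (quad a (u t))⁻¹)
        * quad a (u t) ^ s) t := by
  have hq := quad_pos ha h0
  refine ((hu.quad a).rpow_const (Or.inl hq.ne')).congr_deriv ?_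
  rw [Real.rpow_sub_one hq.ne']
  field_simp

/-- The covector `(Aγ, γ)^{-1/2} λ`, where `λ` is the Liouville 1-form. -/
noncomputable def liouvilleForm (a : Fin (r + 1) → ℝ) (z : Vec r × Vec r) :
    (Vec r × Vec r) →L[ℝ] ℝ :=
  (quad a z.1 ^ ((1 : ℝ) / 2))⁻¹ • (innerSL ℝ z.2).comp (ContinuousLinearMap.fst ℝ (Vec r) (Vec r))

/-- `(Aγ, γ)^{-1/2} λ` as a differential form. -/
noncomputable def liouvilleOneForm (a : Fin (r + 1) → ℝ) (z : Vec r × Vec r) :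
    (Vec r × Vec r) [⋀^Fin 1]→L[ℝ] ℝ :=
  ContinuousAlternatingMap.ofSubsingletonLIE (𝕜 := ℝ) (E := Vec r × Vec r) (F := ℝ)
    (0 : Fin 1) (liouvilleForm a z)

section
variable {a : Fin (r + 1) → ℝ}

lemma contDiffAt_liouvilleForm (ha : ∀ i, 0 < a i) {z : Vec r × Vec r} (hz : z.1 ≠ 0) :
    ContDiffAt ℝ ∞ (liouvilleForm a) z := by
  have hq := quad_pos ha hz
  have h1 : ContDiffAt ℝ ∞ (fun z : Vec r × Vec r => (quad a z.1 ^ ((1 : ℝ) / 2))⁻¹) z :=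
    (ContDiffAt.comp (g := fun x => quad a x ^ ((1 : ℝ) / 2)) z (contDiffAt_quad_rpow ha _ hz)
      contDiffAt_fst).inv (Real.rpow_pos_of_pos hq _).ne'
  have h2 : ContDiffAt ℝ ∞ (fun z : Vec r × Vec r => innerSL ℝ z.2) z :=
    (innerSL ℝ).contDiff.contDiffAt.comp z contDiffAt_snd
  exact h1.smul (h2.clm_comp contDiffAt_const)

lemma contDiffAt_liouvilleOneForm (ha : ∀ i, 0 < a i) {z : Vec r × Vec r} (hz : z.1 ≠ 0) :
    ContDiffAt ℝ ∞ (liouvilleOneForm a) z :=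
  (ContinuousAlternatingMap.ofSubsingletonLIE (𝕜 := ℝ) (E := Vec r × Vec r) (F := ℝ)
    (0 : Fin 1)).contDiff.contDiffAt.comp
    z (contDiffAt_liouvilleForm ha hz)

lemma fderiv_liouvilleForm_apply (ha : ∀ i, 0 < a i) {z : Vec r × Vec r} (hz : z.1 ≠ 0)
    (w w' : Vec r × Vec r) :
    fderiv ℝ (fun y => liouvilleForm a y w') z w = (quad a z.1 ^ ((1 : ℝ) / 2))⁻¹ *
      (inner ℝ w.2 w'.1
        - inner ℝ (act (Matrix.diagonal a) z.1) w.1 * (quad a z.1)⁻¹ * inner ℝ z.2 w'.1) := by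
  have hq := quad_pos ha hz
  have hl : HasDerivAt (fun t : ℝ => z + t • w) w 0 := by
    simpa using ((hasDerivAt_id (0 : ℝ)).smul_const w).const_add z
  have hl1 : HasDerivAt (fun t : ℝ => z.1 + t • w.1) w.1 0 := by
    simpa using ((hasDerivAt_id (0 : ℝ)).smul_const w.1).const_add z.1
  have hl2 : HasDerivAt (fun t : ℝ => z.2 + t • w.2) w.2 0 := by
    simpa using ((hasDerivAt_id (0 : ℝ)).smul_const w.2).const_add z.2
  have h1 : HasFDerivAt (fun y => liouvilleForm a y w') (fderiv ℝ (fun y => liouvilleForm a y w') z)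
      (z + (0 : ℝ) • w) := by
    rw [zero_smul, add_zero]
    exact (((contDiffAt_liouvilleForm ha hz).clm_apply contDiffAt_const).differentiableAt
      (by simp)).hasFDerivAt
  have h2 := h1.comp_hasDerivAt (0 : ℝ) hl
  have hz' : z.1 + (0 : ℝ) • w.1 ≠ 0 := by simpa using hz
  have hs := (Real.rpow_pos_of_pos hq ((1 : ℝ) / 2)).ne'
  have h3 := ((hl1.quad_rpow ha ((1 : ℝ) / 2) hz').inv (by simpa using hs)).mul
    (hl2.inner ℝ (hasDerivAt_const (0 : ℝ) w'.1))
  have h4 := h2.unique h3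
  rw [h4]
  simp only [Pi.inv_apply, zero_smul, add_zero, inner_zero_right, zero_add]
  field_simp
  ring

lemma extDeriv_liouvilleOneForm (ha : ∀ i, 0 < a i) {z : Vec r × Vec r} (hz : z.1 ≠ 0)
    (w w' : Vec r × Vec r) :
    extDeriv (liouvilleOneForm a) z ![w, w'] =
      fderiv ℝ (fun y => liouvilleForm a y w') z w - fderiv ℝ (fun y => liouvilleForm a y w) z w' := by
  rw [extDeriv_apply ((contDiffAt_liouvilleOneForm ha hz).differentiableAt (by simp)),
    Fin.sum_univ_two]
  have e : (Fin.removeNth 1 ![w, w'] : Fin 1 → _) = ![w] := by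
    ext i <;> fin_cases i <;> rfl
  have h : ∀ v y, liouvilleOneForm a y ![v] = liouvilleForm a y v := fun _ _ => rfl
  simp [e, h, sub_eq_add_neg]

lemma _root_.ContDiffAt.extDeriv {E F : Type*} [NormedAddCommGroup E] [NormedSpace ℝ E]
    [NormedAddCommGroup F] [NormedSpace ℝ F] {n : ℕ} {θ : E → E [⋀^Fin n]→L[ℝ] F} {x : E}
    (h : ContDiffAt ℝ ∞ θ x) : ContDiffAt ℝ ∞ (_root_.extDeriv θ) x := by
  let L : (E →L[ℝ] E [⋀^Fin n]→L[ℝ] F) →L[ℝ] E [⋀^Fin (n + 1)]→L[ℝ] F :=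
    ContinuousAlternatingMap.alternatizeUncurryFinCLM ℝ E F
  exact ContDiffAt.continuousLinearMap_comp L (h.fderiv_right (m := ∞) (by simp))

/-- A 2-form that coincides with `(Aγ, γ)^{-1/2} (Ω_can + Ω_𝒯)` on tangent vectors is closed. -/
lemma isClosedForm_of_eq (ha : ∀ i, 0 < a i)
    {β : Vec r × Vec r → Vec r × Vec r → Vec r × Vec r → ℝ}
    (h : ∀ z ∈ TS r, ∀ w w', IsTangentTS z w → IsTangentTS z w' →
      β z w w' = (quad a z.1 ^ ((1 : ℝ) / 2))⁻¹ * (Ωcan w w' + inner ℝ z.2 (gyroMap a z.1 w.1 w'.1))) :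
    IsClosedForm β := by
  -- The rescaled form is exact: its primitive is `-(Aγ, γ)^{-1/2} λ`, which makes sense wherever `γ
  -- ≠ 0`. The sign matches the convention `Ω_can = -dλ`.
  refine ⟨{z | z.1 ≠ 0}, (-1 : ℝ) • extDeriv (liouvilleOneForm a), isOpen_fst_ne_zero,
    TS_subset_ne_zero, fun z hz => ?_, fun z hz w w' hw hw' => ?_, fun z hz w _ => ?_⟩
  · exact (contDiffAt_const.smul (contDiffAt_liouvilleOneForm ha hz).extDeriv).contDiffWithinAt
  · have hz0 := ne_zero_of_mem_Sph hz.1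
    rw [h z hz w w' hw hw', Pi.smul_apply, ContinuousAlternatingMap.smul_apply,
      extDeriv_liouvilleOneForm ha hz0, fderiv_liouvilleForm_apply ha hz0,
      fderiv_liouvilleForm_apply ha hz0, gyroMap_apply, Ωcan, inner_smul_right, inner_sub_right,
      inner_smul_right, inner_smul_right, real_inner_comm w.1 w'.2, real_inner_comm w'.1 w.2,
      smul_eq_mul]
    ring
  · rw [extDeriv_smul, extDeriv_extDeriv_apply
      (contDiffAt_liouvilleOneForm ha (ne_zero_of_mem_Sph hz.1))]
    · simp
    · simp only [minSmoothness_of_isRCLikeNormedField]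
      exact ENat.LEInfty.out

/-- The form `Ω_can + Ω_𝒯` is nondegenerate. -/
lemma eq_zero_of_forall_nh {z w : Vec r × Vec r} (hz : z ∈ TS r) (hw : IsTangentTS z w)
    (h : ∀ w', IsTangentTS z w' → Ωcan w w' + inner ℝ z.2 (gyroMap a z.1 w.1 w'.1) = 0) : w = 0 := by
  have hγ := inner_self_of_mem_Sph hz.1
  -- A vertical test vector does not see the gyroscopic term, so pairing with `(0, w.1)` gives
  -- `|w.1|²`. Once `w.1 = 0`, that term vanishes for all test vectors, and the tangent vector with
  -- base part `w.2` gives `-|w.2|²`.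
  have h1 : w.1 = 0 := by
    have := h (0, w.1) ⟨by simp, by simp [hw.1]⟩
    simpa [Ωcan] using this
  have h2 : w.2 = 0 := by
    have h3 : inner ℝ z.1 w.2 = (0 : ℝ) := by
      have := hw.2
      rwa [h1, inner_zero_left, zero_add] at this
    have := h (w.2, -(inner ℝ w.2 z.2 : ℝ) • z.1) ⟨h3, by
      rw [inner_smul_right, hγ]; ring⟩
    simpa [Ωcan, h1] using this
  exact Prod.ext h1 h2

lemma fderivWithin_redHam (hr : 1 ≤ r) (ha : ∀ i, 0 < a i) {U : Mat r → ℝ} (hU : SmoothOn (SO r) U)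
    (hUinv : ∀ h ∈ SOstab r, ∀ g ∈ SO r, U (h * g) = U g) {H : Vec r × Vec r → ℝ}
    (hH : Set.EqOn H (redHam a U) (TS r)) {z w : Vec r × Vec r} (hz : z ∈ TS r)
    (hw : IsTangentTS z w) :
    fderivWithin ℝ H (TS r) z w =
      (quad a z.1)⁻¹ * inner ℝ (act (Matrix.diagonal a⁻¹) z.2) w.2
      - (quad a z.1)⁻¹ ^ 2 * inner ℝ (act (Matrix.diagonal a) z.1) w.1
          * inner ℝ (act (Matrix.diagonal a⁻¹) z.2) z.2
      + inner ℝ (gradient (redPot U) z.1) w.1 := by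
  obtain ⟨c, rfl, hc, hcS⟩ := hasVelocity_TS hz hw
  have h0 := ne_zero_of_mem_Sph hz.1
  have hq := (quad_pos ha h0).ne'
  have hc1 : HasDerivAt (fun t => (c t).1) w.1 0 :=
    (ContinuousLinearMap.fst ℝ (Vec r) (Vec r)).hasFDerivAt.comp_hasDerivAt (0 : ℝ) hc
  have hc2 : HasDerivAt (fun t => (c t).2) w.2 0 :=
    (ContinuousLinearMap.snd ℝ (Vec r) (Vec r)).hasFDerivAt.comp_hasDerivAt (0 : ℝ) hc
  have hV : HasDerivAt (fun t => redPot U (c t).1) (fderiv ℝ (redPot U) (c 0).1 w.1) 0 :=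
    HasFDerivAt.comp_hasDerivAt (l := redPot U) (0 : ℝ)
      ((contDiffAt_redPot hr hU hUinv h0).differentiableAt (by simp)).hasFDerivAt hc1
  have hder : HasDerivAt (fun t => redHam a U (c t)) _ 0 :=
    ((((hc1.quad a).inv hq).mul (((hasDerivAt_const (0 : ℝ) (Matrix.diagonal a⁻¹ : Mat r)).act
      hc2).inner ℝ hc2)).const_mul (1 / 2)).add hV
  rw [fderivWithin_eq_of_curve hc hcS
    ((contDiffAt_redHam hr ha hU hUinv h0).differentiableAt (by simp)) hH hder, inner_gradient_eq,
    zero_act, add_zero, diagonal_act_inner a⁻¹ w.2, real_inner_comm _ w.2]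
  simp only [Pi.inv_apply]
  field_simp
  ring

/-- Hamilton's equations for the almost symplectic form. -/
lemma nh_redField (ha : ∀ i, 0 < a i) (U : Mat r → ℝ) {z w : Vec r × Vec r} (hz : z ∈ TS r)
    (hw : IsTangentTS z w) :
    Ωcan (redField a U z) w + inner ℝ z.2 (gyroMap a z.1 (redField a U z).1 w.1) =
      (quad a z.1)⁻¹ * inner ℝ (act (Matrix.diagonal a⁻¹) z.2) w.2
      - (quad a z.1)⁻¹ ^ 2 * inner ℝ (act (Matrix.diagonal a) z.1) w.1
          * inner ℝ (act (Matrix.diagonal a⁻¹) z.2) z.2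
      + inner ℝ (gradient (redPot U) z.1) w.1 := by
  have hw1 : inner ℝ w.1 z.1 = (0 : ℝ) := by rw [real_inner_comm]; exact hw.1
  have hw2 : inner ℝ z.1 w.2 = -(inner ℝ z.2 w.1 : ℝ) := by
    have := hw.2
    rw [real_inner_comm] at this
    linarith
  have e1 := inner_diagonal_shapeVel ha hz.1 hz.2
  have e2 := inner_shapeVel_self (a := a) hz.2
  have e3 : inner ℝ (shapeVel a z.1 z.2) w.2 = (quad a z.1)⁻¹ *
      (inner ℝ (act (Matrix.diagonal a⁻¹) z.2) w.2
        - inner ℝ (act (Matrix.diagonal a⁻¹) z.2) z.1 * inner ℝ z.1 w.2 : ℝ) := by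
    simp [shapeVel, inner_smul_left, inner_sub_left]
  -- Of the two gyroscopic terms, the one with `(Aγ, w.1)` is the derivative of `q⁻¹` in the kinetic
  -- energy. The other equals `-q⁻¹ (A⁻¹p, γ) (p, w.1)` and cancels the term that `(γ, w.2) = -(p,
  -- w.1)` produces in `Ω_can`.
  rw [Ωcan, redField, gyroMap_apply]
  simp only
  rw [e3, inner_sub_right, inner_neg_right, inner_smul_right, hw1, inner_smul_right, inner_sub_right,
    inner_smul_right, inner_smul_right, e1, e2, hw2, real_inner_comm (gradient _ _)]
  ring

theorem isHamiltonisedBy (hr : 1 ≤ r) (ha : ∀ i, 0 < a i) {𝕀 : Mat r →ₗ[ℝ] Mat r}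
    (h𝕀 : ∀ u v : Vec r, 𝕀 (wedge u v) =
      wedge (act (Matrix.diagonal a) u) (act (Matrix.diagonal a) v))
    {U : Mat r → ℝ} (hU : SmoothOn (SO r) U)
    (hUinv : ∀ h ∈ SOstab r, ∀ g ∈ SO r, U (h * g) = U g)
    {𝒯 : Vec r → Vec r →ₗ[ℝ] Vec r →ₗ[ℝ] Vec r} (h𝒯 : IsGyroscopicTensor 𝕀 𝒯)
    {H : Vec r × Vec r → ℝ} (hH : IsReducedHamiltonian 𝕀 U H)
    {X : Vec r × Vec r → Vec r × Vec r} (hX : IsReducedField 𝕀 U X) :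
    IsHamiltonisedBy X H (fun γ => quad a γ ^ ((1 : ℝ) / 2))
      (fun z w w' => (quad a z.1 ^ ((1 : ℝ) / 2))⁻¹ * Ωnh 𝒯 z w w') := by
  have hT : ∀ z ∈ TS r, ∀ w w', IsTangentTS z w → IsTangentTS z w' → Ωnh 𝒯 z w w' =
      Ωcan w w' + inner ℝ z.2 (gyroMap a z.1 w.1 w'.1) := fun z hz w w' hw hw' => by
    rw [Ωnh, ΩT, h𝒯.apply_eq hr ha h𝕀 hz.1 hw.1 hw'.1]
  have hpos : ∀ γ ∈ Sph r, 0 < quad a γ ^ ((1 : ℝ) / 2) := fun γ hγ =>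
    Real.rpow_pos_of_pos (quad_pos ha (ne_zero_of_mem_Sph hγ)) _
  refine ⟨smoothOn_Sph_of_contDiffAt fun x hx => contDiffAt_quad_rpow ha _ hx, hpos, ⟨?_, ?_⟩, ?_⟩
  · exact isClosedForm_of_eq ha fun z hz w w' hw hw' => by rw [hT z hz w w' hw hw']
  · intro z hz w hw h
    refine eq_zero_of_forall_nh (a := a) hz hw fun w' hw' => ?_
    rw [← hT z hz w w' hw hw']
    exact (mul_eq_zero.1 (h w' hw')).resolve_left (inv_ne_zero (hpos _ hz.1).ne')
  · intro z hz w hw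
    have hXt := isTangentTS_redField (a := a) hr hU hUinv hz
    rw [hX.eqOn hr ha h𝕀 hU hUinv hz, fderivWithin_redHam hr ha hU hUinv
      (hH.eqOn hr ha h𝕀 hUinv) hz hw, ← nh_redField ha U hz hw, ← hT z hz _ w hXt hw]
    have hc := (hpos _ hz.1).ne'
    beta_reduce
    generalize quad a z.1 ^ ((1 : ℝ) / 2) = c at hc ⊢
    have e : Ωnh 𝒯 z (c • redField a U z) w = c * Ωnh 𝒯 z (redField a U z) w := by
      simp [Ωnh, Ωcan, ΩT, inner_smul_left, inner_smul_right]
      ring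
    rw [e, ← mul_assoc, inv_mul_cancel₀ hc, one_mul]

end

/-! ### The Liouville volume form as an alternating map -/

/-- The even index `2k`. -/
def evenIdx (k : Fin r) : Fin (2 * r) := ⟨2 * k, by omega⟩

/-- The odd index `2k + 1`. -/
def oddIdx (k : Fin r) : Fin (2 * r) := ⟨2 * k + 1, by omega⟩

@[simp] lemma evenIdx_inj {k l : Fin r} : evenIdx k = evenIdx l ↔ k = l := by
  simp [evenIdx, Fin.ext_iff]

@[simp] lemma oddIdx_inj {k l : Fin r} : oddIdx k = oddIdx l ↔ k = l := by
  simp [oddIdx, Fin.ext_iff]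

@[simp] lemma evenIdx_ne_oddIdx (k l : Fin r) : evenIdx k ≠ oddIdx l := by
  simp only [evenIdx, oddIdx, Ne, Fin.ext_iff]; omega

@[simp] lemma oddIdx_ne_evenIdx (k l : Fin r) : oddIdx k ≠ evenIdx l :=
  (evenIdx_ne_oddIdx l k).symm

lemma exists_idx (i : Fin (2 * r)) : ∃ k : Fin r, i = evenIdx k ∨ i = oddIdx k := by
  refine ⟨⟨i / 2, by omega⟩, ?_⟩
  simp only [evenIdx, oddIdx, Fin.ext_iff]
  omega

lemma sum_idx {M : Type*} [AddCommMonoid M] (f : Fin (2 * r) → M) : ∑ i, f i = ∑ k : Fin r, (f (evenIdx k) + f (oddIdx k)) := by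
  have hb : Function.Bijective (Sum.elim evenIdx oddIdx : Fin r ⊕ Fin r → Fin (2 * r)) := by
    constructor
    · rintro (k | k) (l | l) h <;> simp at h ⊢ <;> exact h
    · intro i
      obtain ⟨k, rfl | rfl⟩ := exists_idx i
      exacts [⟨Sum.inl k, rfl⟩, ⟨Sum.inr k, rfl⟩]
  rw [← (Equiv.ofBijective _ hb).sum_comp f, Fintype.sum_sum_type, Finset.sum_add_distrib]
  rfl

lemma Ωcan_add_left (x y w : Vec r × Vec r) : Ωcan (x + y) w = Ωcan x w + Ωcan y w := by
  simp [Ωcan, inner_add_left, inner_add_right]; ring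

lemma Ωcan_smul_left (c : ℝ) (x w : Vec r × Vec r) : Ωcan (c • x) w = c * Ωcan x w := by
  simp [Ωcan, inner_smul_left, inner_smul_right]; ring

lemma Ωcan_swap (x w : Vec r × Vec r) : Ωcan x w = -Ωcan w x := by
  simp [Ωcan]

lemma Ωcan_add_right (x y w : Vec r × Vec r) : Ωcan w (x + y) = Ωcan w x + Ωcan w y := by
  rw [Ωcan_swap, Ωcan_add_left, Ωcan_swap w x, Ωcan_swap w y]; ring

lemma Ωcan_smul_right (c : ℝ) (x w : Vec r × Vec r) : Ωcan w (c • x) = c * Ωcan w x := by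
  rw [Ωcan_swap, Ωcan_smul_left, Ωcan_swap w x]; ring

lemma Ωcan_sum_left {ι : Type*} (s : Finset ι) (f : ι → Vec r × Vec r) (w : Vec r × Vec r) :
    Ωcan (∑ i ∈ s, f i) w = ∑ i ∈ s, Ωcan (f i) w := by
  classical
  induction s using Finset.induction_on with
  | empty => simp [Ωcan]
  | insert i s hi ih => rw [Finset.sum_insert hi, Finset.sum_insert hi, Ωcan_add_left, ih]

lemma prod_update_even (w : Fin (2 * r) → Vec r × Vec r) (k : Fin r) (x : Vec r × Vec r) :
    ∏ l : Fin r, Ωcan (Function.update w (evenIdx k) x (evenIdx l))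
      (Function.update w (evenIdx k) x (oddIdx l)) =
    Ωcan x (w (oddIdx k)) * ∏ l ∈ Finset.univ.erase k, Ωcan (w (evenIdx l)) (w (oddIdx l)) := by
  rw [← Finset.mul_prod_erase _ _ (Finset.mem_univ k)]
  congr 1
  · simp
  · refine Finset.prod_congr rfl fun l hl => ?_
    simp [Finset.ne_of_mem_erase hl]

lemma prod_update_odd (w : Fin (2 * r) → Vec r × Vec r) (k : Fin r) (x : Vec r × Vec r) :
    ∏ l : Fin r, Ωcan (Function.update w (oddIdx k) x (evenIdx l))
      (Function.update w (oddIdx k) x (oddIdx l)) =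
    Ωcan (w (evenIdx k)) x * ∏ l ∈ Finset.univ.erase k, Ωcan (w (evenIdx l)) (w (oddIdx l)) := by
  rw [← Finset.mul_prod_erase _ _ (Finset.mem_univ k)]
  congr 1
  · simp
  · refine Finset.prod_congr rfl fun l hl => ?_
    simp [Finset.ne_of_mem_erase hl]

/-- The tensor power of `Ω_can`. -/
noncomputable def pairProd (r : ℕ) :
    MultilinearMap ℝ (fun _ : Fin (2 * r) => Vec r × Vec r) ℝ where
  toFun w := ∏ k : Fin r, Ωcan (w (evenIdx k)) (w (oddIdx k))
  map_update_add' := by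
    intro inst w i x y
    obtain rfl := Subsingleton.elim inst (instDecidableEqFin (2 * r))
    obtain ⟨k, rfl | rfl⟩ := exists_idx i
    · simp only [prod_update_even, Ωcan_add_left, add_mul]
    · simp only [prod_update_odd, Ωcan_add_right, add_mul]
  map_update_smul' := by
    intro inst w i c x
    obtain rfl := Subsingleton.elim inst (instDecidableEqFin (2 * r))
    obtain ⟨k, rfl | rfl⟩ := exists_idx i
    · simp only [prod_update_even, Ωcan_smul_left, smul_eq_mul, mul_assoc]
    · simp only [prod_update_odd, Ωcan_smul_right, smul_eq_mul, mul_assoc]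

/-- The Liouville volume form, as an alternating map of the ambient space. -/
noncomputable def liouvilleAlt (r : ℕ) : (Vec r × Vec r) [⋀^Fin (2 * r)]→ₗ[ℝ] ℝ :=
  ((1 : ℝ) / 2) ^ r • MultilinearMap.alternatization (pairProd r)

lemma liouvilleAlt_apply (w : Fin (2 * r) → Vec r × Vec r) : liouvilleAlt r w = liouville w := by
  rw [liouvilleAlt, AlternatingMap.smul_apply, MultilinearMap.alternatization_apply, liouville,
    smul_eq_mul]
  congr 1
  refine Finset.sum_congr rfl fun σ _ => ?_
  rw [MultilinearMap.domDomCongr_apply, Units.smul_def, zsmul_eq_mul]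
  rfl

/-- In each summand `y` is paired by `Ω_can` with exactly one of the remaining vectors, so each
summand has a zero factor. No tangency of `y` is required. -/
lemma liouville_update_eq_zero {w : Fin (2 * r) → Vec r × Vec r} {i : Fin (2 * r)}
    {y : Vec r × Vec r} (h : ∀ j, j ≠ i → Ωcan y (w j) = 0) :
    liouville (Function.update w i y) = 0 := by
  rw [liouville]
  refine mul_eq_zero_of_right _ (Finset.sum_eq_zero fun σ _ => mul_eq_zero_of_right _ ?_)
  obtain ⟨k, hk | hk⟩ := exists_idx (σ⁻¹ i)
  · have hk' : σ (evenIdx k) = i := by rw [← hk]; simp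
    have hne : σ (oddIdx k) ≠ i := fun hc => evenIdx_ne_oddIdx k k (σ.injective (hk'.trans hc.symm))
    refine Finset.prod_eq_zero (Finset.mem_univ k) ?_
    change Ωcan (Function.update w i y (σ (evenIdx k))) (Function.update w i y (σ (oddIdx k))) = 0
    rw [hk', Function.update_self, Function.update_of_ne hne, h _ hne]
  · have hk' : σ (oddIdx k) = i := by rw [← hk]; simp
    have hne : σ (evenIdx k) ≠ i := fun hc => evenIdx_ne_oddIdx k k (σ.injective (hc.trans hk'.symm))
    refine Finset.prod_eq_zero (Finset.mem_univ k) ?_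
    change Ωcan (Function.update w i y (σ (evenIdx k))) (Function.update w i y (σ (oddIdx k))) = 0
    rw [hk', Function.update_self, Function.update_of_ne hne, Ωcan_swap, h _ hne, neg_zero]

/-! ### Divergence with respect to an alternating form -/

section Alternating
variable {ι E : Type*} [Fintype ι] [DecidableEq ι] [AddCommGroup E] [Module ℝ E]

/-- The action of an endomorphism on alternating forms, as a derivation. -/
def derivationAlt (L : E [⋀^ι]→ₗ[ℝ] ℝ) (B : E →ₗ[ℝ] E) : E [⋀^ι]→ₗ[ℝ] ℝ where
  toMultilinearMap := ∑ i, L.toMultilinearMap.compLinearMap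
    (Function.update (fun _ => LinearMap.id) i B)
  map_eq_zero_of_eq' v s t hst hne := by
    have key : ∀ i, (L.toMultilinearMap.compLinearMap
        (Function.update (fun _ => LinearMap.id) i B)) v = L (Function.update v i (B (v i))) := by
      intro i
      rw [MultilinearMap.compLinearMap_apply]
      change L _ = L _
      congr 1
      ext j
      by_cases hj : j = i
      · subst hj; simp
      · simp [hj]
    change (∑ i, L.toMultilinearMap.compLinearMap
      (Function.update (fun _ => LinearMap.id) i B)) v = 0
    rw [_root_.sum_apply]
    simp only [key]
    -- Only the terms at `s` and `t` can survive a repetition `v s = v t`: in all others the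
    -- repetition is still present. These two differ by the transposition of `s` and `t`, so they
    -- cancel.
    rw [← Finset.add_sum_erase _ _ (Finset.mem_univ s),
      ← Finset.add_sum_erase _ _ (Finset.mem_erase.2 ⟨hne.symm, Finset.mem_univ t⟩), ← add_assoc]
    have h1 : L (Function.update v s (B (v s))) = -L (Function.update v t (B (v t))) := by
      rw [← L.map_swap _ hne]
      congr 1
      ext j
      simp only [Function.comp]
      by_cases hj : j = s
      · subst hj; simp [hst]
      · by_cases hj' : j = t
        · subst hj'; simp [hne, hne.symm, hst]
        · rw [Equiv.swap_apply_of_ne_of_ne hj hj']; simp [hj, hj']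
    rw [h1, neg_add_cancel, zero_add]
    refine Finset.sum_eq_zero fun i hi => ?_
    have hit := Finset.ne_of_mem_erase hi
    have his := Finset.ne_of_mem_erase (Finset.mem_of_mem_erase hi)
    refine L.map_eq_zero_of_eq _ ?_ hne
    rw [Function.update_of_ne his.symm, Function.update_of_ne hit.symm, hst]

lemma derivationAlt_apply (L : E [⋀^ι]→ₗ[ℝ] ℝ) (B : E →ₗ[ℝ] E) (v : ι → E) :
    derivationAlt L B v = ∑ i, L (Function.update v i (B (v i))) := by
  change (∑ i, L.toMultilinearMap.compLinearMap
      (Function.update (fun _ => LinearMap.id) i B)) v = _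
  rw [_root_.sum_apply]
  refine Finset.sum_congr rfl fun i _ => ?_
  rw [MultilinearMap.compLinearMap_apply]
  change L _ = L _
  congr 1
  ext j
  by_cases hj : j = i
  · subst hj; simp
  · simp [hj]

/-- A top degree form that vanishes on a frame vanishes on the span of the frame. -/
lemma alternating_eq_zero_of_frame (f : E [⋀^ι]→ₗ[ℝ] ℝ) {b : ι → E} (hb : f b = 0) {w : ι → E}
    {c : ι → ι → ℝ} (hw : ∀ i, w i = ∑ j, c i j • b j) : f w = 0 := by
  -- Pulling back to the coordinate space makes the form a multiple of the determinant, the factor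
  -- being its value on the frame. Neither independence of the frame nor top degree in `E` is used.
  set g := f.compLinearMap (Fintype.linearCombination ℝ b) with hg
  have h1 : g (Pi.basisFun ℝ ι) = 0 := by
    rw [hg, AlternatingMap.compLinearMap_apply, ← hb]
    congr 1
    ext i
    simp [Fintype.linearCombination_apply_single]
  have h2 : g = 0 := by
    rw [g.eq_smul_basis_det (Pi.basisFun ℝ ι), h1, zero_smul]
  have h3 : f w = g c := by
    rw [hg, AlternatingMap.compLinearMap_apply]
    congr 1
    ext i
    rw [hw i]
    simp [Fintype.linearCombination_apply]
  rw [h3, h2, AlternatingMap.zero_apply]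

end Alternating

/-! ### A symplectic frame of `T^*S^{n-1}` -/

/-- An orthonormal frame of the orthogonal complement of a unit vector. -/
lemma exists_tangent_frame {γ : Vec r} (hγ : γ ∈ Sph r) : ∃ e : Fin r → Vec r,
    (∀ k, inner ℝ γ (e k) = (0 : ℝ)) ∧
    (∀ k l, inner ℝ (e k) (e l) = if k = l then (1 : ℝ) else 0) ∧
    ∀ x, ∑ k, (inner ℝ (e k) x : ℝ) • e k = x - (inner ℝ γ x : ℝ) • γ := by
  have : Fact (Module.finrank ℝ (Vec r) = r + 1) := ⟨by simp⟩
  set b := OrthonormalBasis.fromOrthogonalSpanSingleton (𝕜 := ℝ) r (ne_zero_of_mem_Sph hγ) with hb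
  have h1 : ∀ k, inner ℝ γ (b k : Vec r) = (0 : ℝ) := fun k =>
    Submodule.mem_orthogonal_singleton_iff_inner_right.1 (b k).2
  refine ⟨fun k => b k, h1, fun k l => ?_, fun x => ?_⟩
  · have := orthonormal_iff_ite.1 b.orthonormal k l
    exact this
  · have hx : x - (inner ℝ γ x : ℝ) • γ ∈ (Submodule.span ℝ {γ})ᗮ := by
      rw [Submodule.mem_orthogonal_singleton_iff_inner_right, inner_sub_right, inner_smul_right,
        inner_self_of_mem_Sph hγ]
      ring
    have h2 := congrArg Subtype.val (b.sum_repr' ⟨_, hx⟩)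
    simp only [Submodule.coe_sum, Submodule.coe_smul, Submodule.coe_inner, inner_sub_right,
      inner_smul_right] at h2
    rw [← h2]
    refine Finset.sum_congr rfl fun k _ => ?_
    rw [real_inner_comm γ, h1 k]
    simp

/-- A frame of `T^*S^{n-1}` built from an orthonormal frame of the sphere. -/
noncomputable def sympFrame (z : Vec r × Vec r) (e : Fin r → Vec r) (i : Fin (2 * r)) :
    Vec r × Vec r :=
  if (i : ℕ) % 2 = 0 then (e ⟨i / 2, by omega⟩, -(inner ℝ (e ⟨i / 2, by omega⟩) z.2 : ℝ) • z.1)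
  else (0, e ⟨i / 2, by omega⟩)

lemma sympFrame_even (z : Vec r × Vec r) (e : Fin r → Vec r) (k : Fin r) :
    sympFrame z e (evenIdx k) = (e k, -(inner ℝ (e k) z.2 : ℝ) • z.1) := by
  simp [sympFrame, evenIdx]

lemma sympFrame_odd (z : Vec r × Vec r) (e : Fin r → Vec r) (k : Fin r) :
    sympFrame z e (oddIdx k) = (0, e k) := by
  have h1 : ¬ (2 * (k : ℕ) + 1) % 2 = 0 := by omega
  have h2 : (2 * (k : ℕ) + 1) / 2 = k := by omega
  simp only [sympFrame, oddIdx, h1, if_false, h2]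

section Frame
variable {z : Vec r × Vec r} {e : Fin r → Vec r}

lemma Ωcan_even_even (h1 : ∀ k, inner ℝ z.1 (e k) = (0 : ℝ)) (k l : Fin r) :
    Ωcan (sympFrame z e (evenIdx k)) (sympFrame z e (evenIdx l)) = 0 := by
  simp [sympFrame_even, Ωcan, inner_smul_right, real_inner_comm z.1, h1]

lemma Ωcan_even_odd (h2 : ∀ k l, inner ℝ (e k) (e l) = if k = l then (1 : ℝ) else 0) (k l : Fin r) :
    Ωcan (sympFrame z e (evenIdx k)) (sympFrame z e (oddIdx l)) = if k = l then 1 else 0 := by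
  simp [sympFrame_even, sympFrame_odd, Ωcan, h2]

lemma Ωcan_odd_odd (k l : Fin r) :
    Ωcan (sympFrame z e (oddIdx k)) (sympFrame z e (oddIdx l)) = 0 := by
  simp [sympFrame_odd, Ωcan]

/-- The component of `x` along the `i`-th vector of the symplectic frame. -/
noncomputable def frameCoeff (z : Vec r × Vec r) (e : Fin r → Vec r) (x : Vec r × Vec r)
    (i : Fin (2 * r)) : ℝ :=
  if (i : ℕ) % 2 = 0 then Ωcan x (sympFrame z e (oddIdx ⟨i / 2, by omega⟩))
  else Ωcan (sympFrame z e (evenIdx ⟨i / 2, by omega⟩)) x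

lemma frameCoeff_even (x : Vec r × Vec r) (k : Fin r) :
    frameCoeff z e x (evenIdx k) = Ωcan x (sympFrame z e (oddIdx k)) := by
  simp [frameCoeff, evenIdx]

lemma frameCoeff_odd (x : Vec r × Vec r) (k : Fin r) :
    frameCoeff z e x (oddIdx k) = Ωcan (sympFrame z e (evenIdx k)) x := by
  have h1 : ¬ (2 * (k : ℕ) + 1) % 2 = 0 := by omega
  have h2 : (2 * (k : ℕ) + 1) / 2 = k := by omega
  simp only [frameCoeff, oddIdx, h1, if_false, h2]

/-- For arbitrary ambient `x`, the combination on the left is the symplectic projection of `x` to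
the span of the frame: the remainder is `Ω_can`-orthogonal to every frame vector. -/
lemma Ωcan_sum_frameCoeff (h1 : ∀ k, inner ℝ z.1 (e k) = (0 : ℝ))
    (h2 : ∀ k l, inner ℝ (e k) (e l) = if k = l then (1 : ℝ) else 0) (x : Vec r × Vec r)
    (j : Fin (2 * r)) :
    Ωcan (∑ i, frameCoeff z e x i • sympFrame z e i) (sympFrame z e j) = Ωcan x (sympFrame z e j) := by
  rw [Ωcan_sum_left, sum_idx]
  obtain ⟨k, rfl | rfl⟩ := exists_idx j
  · have : ∀ l, Ωcan (sympFrame z e (oddIdx l)) (sympFrame z e (evenIdx k)) =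
        -if k = l then 1 else 0 := fun l => by rw [Ωcan_swap, Ωcan_even_odd h2]
    simp only [Ωcan_smul_left, Ωcan_even_even h1, this, frameCoeff_odd]
    simp [← Ωcan_swap]
  · simp only [Ωcan_smul_left, Ωcan_even_odd h2, Ωcan_odd_odd, frameCoeff_even]
    simp

/-- Ambient derivatives of a tangent field need not be tangent. The part of `x` outside the span of
the frame is `Ω_can`-orthogonal to the frame, so it contributes nothing, and by alternation only the
`i`-th component of the rest survives. -/
lemma liouville_update_sympFrame (h1 : ∀ k, inner ℝ z.1 (e k) = (0 : ℝ))
    (h2 : ∀ k l, inner ℝ (e k) (e l) = if k = l then (1 : ℝ) else 0) (i : Fin (2 * r))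
    (x : Vec r × Vec r) :
    liouville (Function.update (sympFrame z e) i x) =
      frameCoeff z e x i * liouville (sympFrame z e) := by
  set t := ∑ i, frameCoeff z e x i • sympFrame z e i with ht
  have h3 : liouville (Function.update (sympFrame z e) i (x - t)) = 0 := by
    refine liouville_update_eq_zero fun j _ => ?_
    rw [sub_eq_add_neg, ← neg_one_smul ℝ t, Ωcan_add_left, Ωcan_smul_left, ht,
      Ωcan_sum_frameCoeff h1 h2]
    ring
  rw [← liouvilleAlt_apply] at h3 ⊢
  rw [AlternatingMap.map_update_sub, sub_eq_zero] at h3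
  rw [h3, ht, AlternatingMap.map_update_sum, Finset.sum_eq_single i]
  · rw [AlternatingMap.map_update_smul, Function.update_eq_self, liouvilleAlt_apply, smul_eq_mul]
  · intro j _ hj
    rw [AlternatingMap.map_update_smul, AlternatingMap.map_update_self _ _ hj.symm, smul_zero]
  · simp

lemma eq_sum_frameCoeff
    (h3 : ∀ x, ∑ k, (inner ℝ (e k) x : ℝ) • e k = x - (inner ℝ z.1 x : ℝ) • z.1)
    {w : Vec r × Vec r} (hw : IsTangentTS z w) :
    w = ∑ i, frameCoeff z e w i • sympFrame z e i := by
  have hw1 : (inner ℝ w.1 z.1 : ℝ) = 0 := by rw [real_inner_comm]; exact hw.1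
  have e1 := h3 w.1
  have e2 := h3 w.2
  rw [hw.1, zero_smul, sub_zero] at e1
  have e3 : ∑ k, (inner ℝ (e k) w.1 * inner ℝ (e k) z.2 : ℝ) = inner ℝ w.1 z.2 := by
    conv_rhs => rw [← e1]
    simp [sum_inner, inner_smul_left]
  have e4 : (inner ℝ z.1 w.2 : ℝ) = -inner ℝ w.1 z.2 := by linarith [hw.2]
  rw [sum_idx]
  simp only [frameCoeff_even, frameCoeff_odd, sympFrame_even, sympFrame_odd, Ωcan, inner_smul_right,
    hw1, inner_zero_left, mul_zero, sub_zero]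
  refine Prod.ext ?_ ?_
  · simp only [Prod.fst_sum, Prod.fst_add, Prod.smul_fst, smul_zero, add_zero]
    conv_lhs => rw [← e1]
    exact Finset.sum_congr rfl fun k _ => by rw [real_inner_comm]
  · simp only [Prod.snd_sum, Prod.snd_add, Prod.smul_snd, Finset.sum_add_distrib, e2, smul_smul,
      ← Finset.sum_smul, mul_neg, Finset.sum_neg_distrib, real_inner_comm (e _) w.1]
    rw [e3, e4]
    module

/-- The divergence of an endomorphism, with respect to the Liouville volume form. -/
lemma derivationAlt_liouville (h1 : ∀ k, inner ℝ z.1 (e k) = (0 : ℝ))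
    (h2 : ∀ k l, inner ℝ (e k) (e l) = if k = l then (1 : ℝ) else 0)
    (B : (Vec r × Vec r) →ₗ[ℝ] Vec r × Vec r) :
    derivationAlt (liouvilleAlt r) B (sympFrame z e) =
      (∑ k, (Ωcan (B (sympFrame z e (evenIdx k))) (sympFrame z e (oddIdx k))
        + Ωcan (sympFrame z e (evenIdx k)) (B (sympFrame z e (oddIdx k)))))
        * liouville (sympFrame z e) := by
  rw [derivationAlt_apply, sum_idx, Finset.sum_mul]
  refine Finset.sum_congr rfl fun k _ => ?_
  rw [liouvilleAlt_apply, liouvilleAlt_apply, liouville_update_sympFrame h1 h2,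
    liouville_update_sympFrame h1 h2, frameCoeff_even, frameCoeff_odd]
  ring

end Frame

/-! ### The invariant measure -/

section Measure
variable {a : Fin (r + 1) → ℝ}

lemma hasDerivAt_shapeVel (ha : ∀ i, 0 < a i) {γ p : ℝ → Vec r} {γ' p' : Vec r} {t : ℝ}
    (hγ : HasDerivAt γ γ' t) (hp : HasDerivAt p p' t) (h0 : γ t ≠ 0) :
    HasDerivAt (fun s => shapeVel a (γ s) (p s))
      ((quad a (γ t))⁻¹ • (act (Matrix.diagonal a⁻¹) p'
        - (inner ℝ (act (Matrix.diagonal a⁻¹) (p t)) γ' : ℝ) • γ t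
        - (inner ℝ (act (Matrix.diagonal a⁻¹) p') (γ t) : ℝ) • γ t
        - (inner ℝ (act (Matrix.diagonal a⁻¹) (p t)) (γ t) : ℝ) • γ'
        - (2 * inner ℝ (act (Matrix.diagonal a) (γ t)) γ' : ℝ) • shapeVel a (γ t) (p t))) t := by
  have hq := (quad_pos ha h0).ne'
  have hb : HasDerivAt (fun s => act (Matrix.diagonal a⁻¹) (p s))
      (act (Matrix.diagonal a⁻¹) p') t := by
    simpa using (hasDerivAt_const t (Matrix.diagonal a⁻¹ : Mat r)).act hp
  have h : HasDerivAt (fun s => shapeVel a (γ s) (p s)) _ t :=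
    ((hγ.quad a).inv hq).smul (hb.sub ((hb.inner ℝ hγ).smul hγ))
  refine h.congr_deriv ?_
  rw [shapeVel]
  simp only [Pi.inv_apply]
  match_scalars <;> field_simp <;> ring

lemma hasDerivAt_redField_line (hr : 1 ≤ r) (ha : ∀ i, 0 < a i) {U : Mat r → ℝ}
    (hU : SmoothOn (SO r) U) (hUinv : ∀ h ∈ SOstab r, ∀ g ∈ SO r, U (h * g) = U g)
    {z : Vec r × Vec r} (hz : z.1 ≠ 0) (w : Vec r × Vec r) :
    HasDerivAt (fun t : ℝ => redField a U (z + t • w)) (fderiv ℝ (redField a U) z w) 0 := by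
  have hl : HasDerivAt (fun t : ℝ => z + t • w) w 0 := by
    simpa using ((hasDerivAt_id (0 : ℝ)).smul_const w).const_add z
  have h1 : HasFDerivAt (redField a U) (fderiv ℝ (redField a U) z) (z + (0 : ℝ) • w) := by
    rw [zero_smul, add_zero]
    exact ((contDiffAt_redField hr ha hU hUinv hz).differentiableAt (by simp)).hasFDerivAt
  exact h1.comp_hasDerivAt (0 : ℝ) hl

lemma hasDerivAt_line (x v : Vec r) : HasDerivAt (fun t : ℝ => x + t • v) v 0 := by
  simpa using ((hasDerivAt_id (0 : ℝ)).smul_const v).const_add x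

lemma fderiv_redField_fst (hr : 1 ≤ r) (ha : ∀ i, 0 < a i) {U : Mat r → ℝ} (hU : SmoothOn (SO r) U)
    (hUinv : ∀ h ∈ SOstab r, ∀ g ∈ SO r, U (h * g) = U g) {z : Vec r × Vec r} (hz : z.1 ≠ 0)
    (w : Vec r × Vec r) :
    (fderiv ℝ (redField a U) z w).1 =
      (quad a z.1)⁻¹ • (act (Matrix.diagonal a⁻¹) w.2
        - (inner ℝ (act (Matrix.diagonal a⁻¹) z.2) w.1 : ℝ) • z.1
        - (inner ℝ (act (Matrix.diagonal a⁻¹) w.2) z.1 : ℝ) • z.1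
        - (inner ℝ (act (Matrix.diagonal a⁻¹) z.2) z.1 : ℝ) • w.1
        - (2 * inner ℝ (act (Matrix.diagonal a) z.1) w.1 : ℝ) • shapeVel a z.1 z.2) := by
  have h2 := (ContinuousLinearMap.fst ℝ (Vec r) (Vec r)).hasFDerivAt.comp_hasDerivAt (0 : ℝ)
    (hasDerivAt_redField_line (a := a) hr ha hU hUinv hz w)
  have h3 := hasDerivAt_shapeVel ha (hasDerivAt_line z.1 w.1) (hasDerivAt_line z.2 w.2)
    (by simpa using hz)
  simp only [zero_smul, add_zero] at h3
  exact h2.unique h3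

/-- The gradient term does not depend on `p`, and what remains of the second component is a multiple
of `γ`. Paired with the frame vectors `e k ⟂ γ` it disappears, so its coefficient need not be known.
-/
lemma fderiv_redField_vertical (hr : 1 ≤ r) (ha : ∀ i, 0 < a i) {U : Mat r → ℝ}
    (hU : SmoothOn (SO r) U) (hUinv : ∀ h ∈ SOstab r, ∀ g ∈ SO r, U (h * g) = U g)
    {z : Vec r × Vec r} (hz : z.1 ≠ 0) (v : Vec r) :
    ∃ c : ℝ, (fderiv ℝ (redField a U) z (0, v)).2 = c • z.1 := by
  have hv := (hasDerivAt_line z.2 v).inner ℝ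
    (hasDerivAt_shapeVel ha (hasDerivAt_const (0 : ℝ) z.1) (hasDerivAt_line z.2 v) hz)
  have h2 := (ContinuousLinearMap.snd ℝ (Vec r) (Vec r)).hasFDerivAt.comp_hasDerivAt (0 : ℝ)
    (hasDerivAt_redField_line (a := a) hr ha hU hUinv hz (0, v))
  have h3 := (hv.smul_const z.1).const_sub (-gradient (redPot U) z.1)
  have e : (ContinuousLinearMap.snd ℝ (Vec r) (Vec r)) ∘
      (fun t : ℝ => redField a U (z + t • ((0 : Vec r), v))) = fun t : ℝ =>
        -gradient (redPot U) z.1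
          - (inner ℝ (z.2 + t • v) (shapeVel a z.1 (z.2 + t • v)) : ℝ) • z.1 := by
    ext1 t
    simp [redField]
  rw [e] at h2
  exact ⟨_, (h2.unique h3).trans (neg_smul _ _).symm⟩

/-- Second derivatives of the potential never enter, since the odd frame vectors `(0, e k)` see only
the first component of the derivative. With `b = (A⁻¹p, γ)`, the sum over the frame of the
first-component terms is `q⁻¹ (-b - r b + 2 b)`. -/
lemma sum_divergence (hr : 1 ≤ r) (ha : ∀ i, 0 < a i) {U : Mat r → ℝ} (hU : SmoothOn (SO r) U)
    (hUinv : ∀ h ∈ SOstab r, ∀ g ∈ SO r, U (h * g) = U g) {z : Vec r × Vec r} (hz : z ∈ TS r)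
    {e : Fin r → Vec r} (h1 : ∀ k, inner ℝ z.1 (e k) = (0 : ℝ))
    (h2 : ∀ k l, inner ℝ (e k) (e l) = if k = l then (1 : ℝ) else 0)
    (h3 : ∀ x, ∑ k, (inner ℝ (e k) x : ℝ) • e k = x - (inner ℝ z.1 x : ℝ) • z.1) :
    ∑ k, (Ωcan (fderiv ℝ (redField a U) z (sympFrame z e (evenIdx k))) (sympFrame z e (oddIdx k))
        + Ωcan (sympFrame z e (evenIdx k)) (fderiv ℝ (redField a U) z (sympFrame z e (oddIdx k)))) =
      (1 - r) * (quad a z.1)⁻¹ * inner ℝ (act (Matrix.diagonal a⁻¹) z.2) z.1 := by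
  have h0 := ne_zero_of_mem_Sph hz.1
  have hγ := inner_self_of_mem_Sph hz.1
  have h1' : ∀ k, (inner ℝ (e k) z.1 : ℝ) = 0 := fun k => by rw [real_inner_comm]; exact h1 k
  -- Parseval's identity for a frame of the complement of `γ`; one of the two vectors must be
  -- orthogonal to `γ`.
  have hpars : ∀ x y, (inner ℝ z.1 y : ℝ) = 0 → ∑ k, (inner ℝ x (e k) * inner ℝ y (e k) : ℝ) = inner ℝ x y := by
    intro x y hy
    have := congrArg (fun u => (inner ℝ x u : ℝ)) (h3 y)
    simp only [inner_sum, inner_smul_right, hy, zero_smul, sub_zero] at this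
    rw [← this]
    exact Finset.sum_congr rfl fun k _ => by rw [real_inner_comm (e k) y]; ring
  have key : ∀ k, Ωcan (fderiv ℝ (redField a U) z (sympFrame z e (evenIdx k)))
        (sympFrame z e (oddIdx k))
      + Ωcan (sympFrame z e (evenIdx k)) (fderiv ℝ (redField a U) z (sympFrame z e (oddIdx k))) =
      (quad a z.1)⁻¹ * (-(inner ℝ (act (Matrix.diagonal a⁻¹) z.1) (e k) * inner ℝ z.2 (e k))
        - inner ℝ (act (Matrix.diagonal a⁻¹) z.2) z.1
        - 2 * (inner ℝ (act (Matrix.diagonal a) z.1) (e k) * inner ℝ (shapeVel a z.1 z.2) (e k)) : ℝ) := by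
    intro k
    obtain ⟨c, hc⟩ := fderiv_redField_vertical hr ha hU hUinv (a := a) h0 (e k)
    have hkk : (inner ℝ (e k) (e k) : ℝ) = 1 := by rw [h2]; simp
    rw [sympFrame_even, sympFrame_odd, Ωcan, Ωcan, fderiv_redField_fst hr ha hU hUinv h0,
      fderiv_redField_fst hr ha hU hUinv h0, hc]
    simp only [inner_smul_left, inner_smul_right, inner_sub_left, inner_zero_left, inner_zero_right,
      act_smul, h1, h1', hkk, hγ, real_inner_comm (e k) z.2, conj_trivial]
    ring
  simp only [key]
  rw [← Finset.mul_sum, Finset.sum_sub_distrib, Finset.sum_sub_distrib, Finset.sum_neg_distrib,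
    ← Finset.mul_sum, hpars _ _ hz.2, hpars _ _ (inner_shapeVel hz.1 _),
    inner_diagonal_shapeVel ha hz.1 hz.2, diagonal_act_inner a⁻¹ z.1, real_inner_comm _ z.1]
  simp
  ring

theorem preservesBasicMeasure (hr : 1 ≤ r) (ha : ∀ i, 0 < a i) {𝕀 : Mat r →ₗ[ℝ] Mat r}
    (h𝕀 : ∀ u v : Vec r, 𝕀 (wedge u v) =
      wedge (act (Matrix.diagonal a) u) (act (Matrix.diagonal a) v))
    {U : Mat r → ℝ} (hU : SmoothOn (SO r) U)
    (hUinv : ∀ h ∈ SOstab r, ∀ g ∈ SO r, U (h * g) = U g)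
    {X : Vec r × Vec r → Vec r × Vec r} (hX : IsReducedField 𝕀 U X) :
    PreservesBasicMeasure X (fun γ => quad a γ ^ ((2 - ((r + 1 : ℕ) : ℝ)) / 2)) := by
  refine ⟨smoothOn_Sph_of_contDiffAt fun x hx => contDiffAt_quad_rpow ha _ hx, fun γ hγ =>
    Real.rpow_pos_of_pos (quad_pos ha (ne_zero_of_mem_Sph hγ)) _, fun z hz w hw => ?_⟩
  have h0 := ne_zero_of_mem_Sph hz.1
  have hXeq := hX.eqOn hr ha h𝕀 hU hUinv
  have hXz := hX.2.1 z hz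
  obtain ⟨e, h1, h2, h3⟩ := exists_tangent_frame hz.1
  set s : ℝ := (2 - ((r + 1 : ℕ) : ℝ)) / 2 with hs
  have hB : ∀ w, IsTangentTS z w →
      fderivWithin ℝ X (TS r) z w = fderiv ℝ (redField a U) z w := fun w hw =>
    (hasVelocity_TS hz hw).fderivWithin_eq
      ((contDiffAt_redField hr ha hU hUinv h0).differentiableAt (by simp)).hasFDerivAt hXeq
  have hf : fderivWithin ℝ (fun y : Vec r × Vec r => quad a y.1 ^ s) (TS r) z (X z) =
      2 * s * (inner ℝ (act (Matrix.diagonal a) z.1) (X z).1 * (quad a z.1)⁻¹) * quad a z.1 ^ s := by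
    obtain ⟨c, rfl, hc, hcS⟩ := hasVelocity_TS hz hXz
    have hc1 : HasDerivAt (fun t => (c t).1) (X (c 0)).1 0 :=
      (ContinuousLinearMap.fst ℝ (Vec r) (Vec r)).hasFDerivAt.comp_hasDerivAt (0 : ℝ) hc
    refine fderivWithin_eq_of_curve hc hcS (F := fun y : Vec r × Vec r => quad a y.1 ^ s) ?_
      (fun _ _ => rfl) (hc1.quad_rpow ha s h0)
    exact (ContDiffAt.comp (g := fun x => quad a x ^ s) (c 0) (contDiffAt_quad_rpow ha s h0)
      contDiffAt_fst).differentiableAt (by simp)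
  have hX1 : (inner ℝ (act (Matrix.diagonal a) z.1) (X z).1 : ℝ) =
      -inner ℝ (act (Matrix.diagonal a⁻¹) z.2) z.1 := by
    rw [hXeq hz]
    exact inner_diagonal_shapeVel ha hz.1 hz.2
  set B : (Vec r × Vec r) →ₗ[ℝ] Vec r × Vec r := (fderiv ℝ (redField a U) z).toLinearMap with hBdef
  set k := fderivWithin ℝ (fun y : Vec r × Vec r => quad a y.1 ^ s) (TS r) z (X z) with hk
  -- As a function of `w`, the Lie derivative of the density is an alternating form of degree `2r`,
  -- and tangent vectors lie in the span of the `2r` frame vectors. Its vanishing on the frame alone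
  -- is therefore enough.
  have hmain := alternating_eq_zero_of_frame
    (k • liouvilleAlt r + (quad a z.1 ^ s) • derivationAlt (liouvilleAlt r) B)
    (b := sympFrame z e) (w := w) (c := fun i j => frameCoeff z e (w i) j) ?_
    (fun i => eq_sum_frameCoeff h3 (hw i))
  · rw [AlternatingMap.add_apply, AlternatingMap.smul_apply, AlternatingMap.smul_apply,
      derivationAlt_apply, liouvilleAlt_apply, smul_eq_mul, smul_eq_mul, Finset.mul_sum] at hmain
    rw [← hmain]
    congr 1
    refine Finset.sum_congr rfl fun i _ => ?_
    rw [liouvilleAlt_apply, hB _ (hw i)]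
    rfl
  · rw [AlternatingMap.add_apply, AlternatingMap.smul_apply, AlternatingMap.smul_apply,
      derivationAlt_liouville h1 h2, liouvilleAlt_apply, smul_eq_mul, smul_eq_mul, hf, hX1]
    have hd := sum_divergence hr ha hU hUinv hz h1 h2 h3
    change _ + _ * ((∑ k, (Ωcan (fderiv ℝ (redField a U) z (sympFrame z e (evenIdx k)))
      (sympFrame z e (oddIdx k)) + Ωcan (sympFrame z e (evenIdx k))
        (fderiv ℝ (redField a U) z (sympFrame z e (oddIdx k))))) * _) = 0
    -- With `b = (A⁻¹p, γ)`, the density `q^s` contributes `-2 s b / q` and the divergence `(1 - r)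
    -- b / q`; the sum vanishes exactly for the exponent `s = (1 - r) / 2`.
    rw [hd, hs]
    push_cast
    ring

end Measure

end Veselova

/-! ### The Veselova system: existence of the reduced data and the three claims -/

theorem theoremT (r : ℕ) (hr : 1 ≤ r)
    (a : Fin (r + 1) → ℝ) (ha : ∀ i, 0 < a i)
    (𝕀 : Veselova.Mat r →ₗ[ℝ] Veselova.Mat r)
    (h𝕀 : ∀ u v : Veselova.Vec r, 𝕀 (Veselova.wedge u v) =
      Veselova.wedge (Veselova.act (Matrix.diagonal a) u) (Veselova.act (Matrix.diagonal a) v))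
    (U : Veselova.Mat r → ℝ) (hU : Veselova.SmoothOn (Veselova.SO r) U)
    (hUinv : ∀ h ∈ Veselova.SOstab r, ∀ g ∈ Veselova.SO r, U (h * g) = U g) :
    Veselova.IsChaplyginSystem 𝕀 U ∧
    (∃ 𝒯, Veselova.IsGyroscopicTensor 𝕀 𝒯) ∧
    (∃ H, Veselova.IsReducedHamiltonian 𝕀 U H) ∧
    (∃ X, Veselova.IsReducedField 𝕀 U X) ∧
    ∀ 𝒯 H X, Veselova.IsGyroscopicTensor 𝕀 𝒯 → Veselova.IsReducedHamiltonian 𝕀 U H →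
      Veselova.IsReducedField 𝕀 U X →
      Veselova.IsPhiSimple 𝒯 (fun γ => -(1 / 2) * Real.log (Veselova.quad a γ)) ∧
      Veselova.PreservesBasicMeasure X
        (fun γ => Veselova.quad a γ ^ ((2 - ((r + 1 : ℕ) : ℝ)) / 2)) ∧
      Veselova.IsHamiltonisedBy X H (fun γ => Veselova.quad a γ ^ ((1 : ℝ) / 2))
        (fun z w w' => (Veselova.quad a z.1 ^ ((1 : ℝ) / 2))⁻¹ * Veselova.Ωnh 𝒯 z w w') := by
  refine ⟨Veselova.isChaplyginSystem hr ha h𝕀 hUinv,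
    ⟨_, Veselova.isGyroscopicTensor_gyroMap ha h𝕀⟩,
    ⟨_, Veselova.isReducedHamiltonian_redHam hr ha h𝕀 hU hUinv⟩,
    ⟨_, Veselova.isReducedField_redField hr ha h𝕀 hU hUinv⟩, fun 𝒯 H X h𝒯 hH hX => ⟨?_, ?_, ?_⟩⟩
  · exact Veselova.isPhiSimple hr ha h𝕀 h𝒯
  · exact Veselova.preservesBasicMeasure hr ha h𝕀 hU hUinv hX
  · exact Veselova.isHamiltonisedBy hr ha h𝕀 hU hUinv h𝒯 hH hX
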